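/- Let $Y\in\mathbb{R}^{N\times T}$ be panel data following the linear model $Y=\sum_{d=1}^D\beta_d X^{(d)}+\epsilon$, where $X^{(1)},\dots,X^{(D)}\in\mathbb{R}^{N\times T}$ are fixed covariate matrices, $\beta\in\mathbb{R}^D$ is a nonrandom vector and $\epsilon$ is a random $N\times T$ matrix of errors. Let $C_1,\dots,C_M$ be a partition of $[N]$ into $M\ge 2$ clusters, and write $A_{C_m}$ for the submatrix of the rows of $A$ with index in $C_m$ and $A_i\in\mathbb{R}^T$ for the $i$th row of $A$. Let $P\in\mathbb{R}^{T\times T}$ be a symmetric matrix with $P^2=I_T$ (the law of $\epsilon$ need not be invariant under $P$). *Residuals.* Let $\hat\epsilon\in\mathbb{R}^{N\times T}$ be the matrix whose block $\hat\epsilon_{C_m}$ is, for each $m$, the matrix of ordinary least squares residuals of $Y_{C_m}$ on the covariates $X^{(1)}_{C_m},\dots,X^{(D)}_{C_m}, (X^{(1)}P)_{C_m},\dots,(X^{(D)}P)_{C_m}$, computed within the cluster. Let $B_1,\dots,B_M$ be i.i.d. Bernoulli$(1/2)$ variables independent of the data, let $\tilde\epsilon$ be given by $\tilde\epsilon_{C_m}=\hat\epsilon_{C_m}P^{B_m}$,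 and let $\tilde{\mathbb{E}}$ denote expectation over $B_1,\dots,B_M$ conditional on the data. *Statistic.* Let $(s_{ij})_{i,j\in[N]}$ be real weights with $s_{ij}=s_{ji}$ and $\sum_{i\in C_m}\sum_{j\in C_{m'}}s_{ij}^2=1$ for all $m\ne m'$. Put $$S(R)=\sum_{m=1}^M\sum_{i\in C_m}\sum_{j\notin C_m}s_{ij}R_i^\top R_j,\qquad S=S(\hat\epsilon),\quad \tilde S=S(\tilde\epsilon),$$ $$\Delta=\frac{S-\tilde{\mathbb{E}}[\tilde S]}{\sigma},\qquad \tilde\Delta=\frac{\tilde S-\tilde{\mathbb{E}}[\tilde S]}{\sigma},\qquad \sigma=\sqrt{\operatorname{Var}(S-\tilde{\mathbb{E}}[\tilde S])},$$ $$\delta_{m,m'}=\sum_{i\in C_m,\,j\in C_{m'}}s_{ij}\,\hat\epsilon_i^\top(I_T-P)\hat\epsilon_j,\qquad \sigma_\delta^2=\frac{1}{\binom M2}\sum_{m<m'}\operatorname{Var}\Big(\frac{1}{\sqrt T}\delta_{m,m'}\Big).$$ *Assumptions.* Suppose that $\mathbb{E}[\epsilon]=0$, that $\epsilon_{C_1},\dots,\epsilon_{C_M}$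 are jointly independent, that $\sigma_\delta^2>0$, and that $\epsilon$ is jointly sub-Gaussian, i.e. has finite Luxemburg norm $$C_{\mathrm{subG}}=\inf\Big\{\kappa>0:\ \sup_{A\in\mathbb{R}^{N\times T},\,\|A\|_{\mathrm{Fr}}=1}\mathbb{E}\big[\exp\big(\operatorname{tr}(A^\top\epsilon)^2/\kappa^2\big)\big]\le 2\Big\}.$$ *Conclusion.* For $K\in\mathbb{N}$ let $\mu_K=\mathbb{E}[\Delta^K]$ and $\tilde\mu_K=\tilde{\mathbb{E}}[\tilde\Delta^K]$ be the $K$th moments of the unconditional and of the randomization distribution; the latter is a random variable. Then $\mathbb{E}|\Delta|^K<\infty$ and, for each $K$, there is a constant $a_K$ depending only on $K$ and $C_{\mathrm{subG}}$ (and so not on $N$, $T$, $M$, $D$, the clusters, the weights, the covariates, $P$ or the law of $\epsilon$ otherwise) such that $$\mathbb{E}\big[(\mu_K-\tilde\mu_K)^2\big]\le\frac{a_K}{\sigma_\delta^{2K}}\cdot\frac1M .$$ -/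

import Mathlib

open MeasureTheory ProbabilityTheory
open scoped ENNReal Matrix

noncomputable section

/-! Panel data: `N` units, `T` time points, `D` covariates. A clustering `C_1, …, C_M` of the units
is given by the map `c : Fin N → Fin M` that sends a unit to its cluster. -/

namespace Panel

variable {N T M D : ℕ}

/-- The set of `κ > 0` with `sup_A E[exp(tr(Aᵀ ε)² / κ²)] ≤ 2`, the supremum being over the
matrices `A` of Frobenius norm one. -/
def luxemburgSet {Ω : Type*} [MeasurableSpace Ω] (μ : Measure Ω)
    (ε : Ω → Matrix (Fin N) (Fin T) ℝ) : Set ℝ :=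
  {κ : ℝ | 0 < κ ∧ ∀ A : Matrix (Fin N) (Fin T) ℝ, (∑ i, ∑ t, A i t ^ 2) = 1 →
    ∫⁻ ω, ENNReal.ofReal (Real.exp ((Matrix.trace (Aᵀ * ε ω)) ^ 2 / κ ^ 2)) ∂μ ≤ 2}

/-- A random matrix is (jointly) sub-Gaussian if its Luxemburg norm is finite, i.e. if the infimum
defining that norm is over a non-empty set. -/
def IsSubGaussian {Ω : Type*} [MeasurableSpace Ω] (μ : Measure Ω)
    (ε : Ω → Matrix (Fin N) (Fin T) ℝ) : Prop :=
  (luxemburgSet μ ε).Nonempty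

/-- The Luxemburg (sub-Gaussian) norm of a sub-Gaussian random matrix. -/
def luxemburgNorm {Ω : Type*} [MeasurableSpace Ω] (μ : Measure Ω)
    (ε : Ω → Matrix (Fin N) (Fin T) ℝ) : ℝ :=
  sInf (luxemburgSet μ ε)

/-- The submatrix of the rows that belong to cluster `m`. -/
def block (c : Fin N → Fin M) (m : Fin M) (A : Matrix (Fin N) (Fin T) ℝ) :
    {i : Fin N // c i = m} → Fin T → ℝ :=
  fun i t => A i t

/-- The null hypothesis: the clusters of errors are jointly independent. -/
def ClusterIndep {Ω : Type*} [MeasurableSpace Ω] (μ : Measure Ω) (c : Fin N → Fin M)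
    (ε : Ω → Matrix (Fin N) (Fin T) ℝ) : Prop :=
  iIndepFun (fun (m : Fin M) (ω : Ω) => block c m (ε ω)) μ

/-- The errors have mean zero. -/
def IsMeanZero {Ω : Type*} [MeasurableSpace Ω] (μ : Measure Ω)
    (ε : Ω → Matrix (Fin N) (Fin T) ℝ) : Prop :=
  ∀ i t, Integrable (fun ω => ε ω i t) μ ∧ ∫ ω, ε ω i t ∂μ = 0

/-- The block of cluster `m`, vectorized. -/
def blockVec (c : Fin N → Fin M) (m : Fin M) (A : Matrix (Fin N) (Fin T) ℝ) :
    EuclideanSpace ℝ ({i : Fin N // c i = m} × Fin T) :=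
  WithLp.toLp 2 (fun p => block c m A p.1 p.2)

/-- The column space of the invariance-augmented design of cluster `m`, spanned by the blocks of
the covariates `X^(d)` and of the transformed covariates `X^(d) P`. -/
def designSpace (c : Fin N → Fin M) (P : Matrix (Fin T) (Fin T) ℝ)
    (X : Fin D → Matrix (Fin N) (Fin T) ℝ) (m : Fin M) :
    Submodule ℝ (EuclideanSpace ℝ ({i : Fin N // c i = m} × Fin T)) :=
  Submodule.span ℝ
    (Set.range (fun d => blockVec c m (X d)) ∪ Set.range (fun d => blockVec c m (X d * P)))

/-- The OLS residuals of cluster `m` in the augmented model, from the data of that cluster only: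
the outcomes minus their least squares fit, that is, minus their orthogonal projection onto the
column space of the design. -/
def clusterResid (c : Fin N → Fin M) (P : Matrix (Fin T) (Fin T) ℝ)
    (X : Fin D → Matrix (Fin N) (Fin T) ℝ) (Y : Matrix (Fin N) (Fin T) ℝ) (m : Fin M) :
    EuclideanSpace ℝ ({i : Fin N // c i = m} × Fin T) :=
  blockVec c m Y - (designSpace c P X m).starProjection (blockVec c m Y)

/-- The mosaic residuals: the concatenation of the cluster-by-cluster OLS residuals. -/
def mosaicResid (c : Fin N → Fin M) (P : Matrix (Fin T) (Fin T) ℝ)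
    (X : Fin D → Matrix (Fin N) (Fin T) ℝ) (Y : Matrix (Fin N) (Fin T) ℝ) :
    Matrix (Fin N) (Fin T) ℝ :=
  Matrix.of fun i t => clusterResid c P X Y (c i) (⟨i, rfl⟩, t)

/-- The randomized residuals for given coin flips `b`: the residuals `R_{C_m}` of cluster `m` are
replaced by `R_{C_m} P ^ {b_m}`. -/
def mosaicRandomize (c : Fin N → Fin M) (P : Matrix (Fin T) (Fin T) ℝ) (b : Fin M → Bool)
    (R : Matrix (Fin N) (Fin T) ℝ) : Matrix (Fin N) (Fin T) ℝ :=
  Matrix.of fun i t => (R * P ^ (b (c i)).toNat) i t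

/-- Expectation over the coin flips `B_1, …, B_M`, i.i.d. Bernoulli(1/2), with the data held fixed:
all `2 ^ M` outcomes are equally likely. -/
def randExp (f : (Fin M → Bool) → ℝ) : ℝ :=
  (∑ b, f b) / 2 ^ M

/-- The quadratic statistic `S(R) = ∑_m ∑_{i ∈ C_m} ∑_{j ∉ C_m} s_ij R_iᵀ R_j`. -/
def quadStat (c : Fin N → Fin M) (s : Matrix (Fin N) (Fin N) ℝ) (R : Matrix (Fin N) (Fin T) ℝ) :
    ℝ :=
  ∑ m : Fin M, ∑ i with c i = m, ∑ j with c j ≠ m, s i j * (R i ⬝ᵥ R j)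

/-- The centered statistic `S(R) - Ẽ[S(R̃)]`. -/
def centeredStat (c : Fin N → Fin M) (P : Matrix (Fin T) (Fin T) ℝ)
    (s : Matrix (Fin N) (Fin N) ℝ) (R : Matrix (Fin N) (Fin T) ℝ) : ℝ :=
  quadStat c s R - randExp fun b => quadStat c s (mosaicRandomize c P b R)

/-- The centered randomized statistic `S(R̃) - Ẽ[S(R̃)]`, for given coin flips. -/
def centeredRandStat (c : Fin N → Fin M) (P : Matrix (Fin T) (Fin T) ℝ)
    (s : Matrix (Fin N) (Fin N) ℝ) (b : Fin M → Bool) (R : Matrix (Fin N) (Fin T) ℝ) : ℝ :=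
  quadStat c s (mosaicRandomize c P b R)
    - randExp fun b' => quadStat c s (mosaicRandomize c P b' R)

/-- The standard deviation `σ` of `S - Ẽ[S̃]`, for random residuals `R`. -/
def sigma {Ω : Type*} [MeasurableSpace Ω] (μ : Measure Ω) (c : Fin N → Fin M)
    (P : Matrix (Fin T) (Fin T) ℝ) (s : Matrix (Fin N) (Fin N) ℝ)
    (R : Ω → Matrix (Fin N) (Fin T) ℝ) : ℝ :=
  √(variance (fun ω => centeredStat c P s (R ω)) μ)

/-- The normalized statistic `Δ`. -/
def Delta {Ω : Type*} [MeasurableSpace Ω] (μ : Measure Ω) (c : Fin N → Fin M)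
    (P : Matrix (Fin T) (Fin T) ℝ) (s : Matrix (Fin N) (Fin N) ℝ)
    (R : Ω → Matrix (Fin N) (Fin T) ℝ) (ω : Ω) : ℝ :=
  centeredStat c P s (R ω) / sigma μ c P s R

/-- The normalized randomized statistic `Δ̃`, for the data `ω` and the coin flips `b`. -/
def DeltaRand {Ω : Type*} [MeasurableSpace Ω] (μ : Measure Ω) (c : Fin N → Fin M)
    (P : Matrix (Fin T) (Fin T) ℝ) (s : Matrix (Fin N) (Fin N) ℝ)
    (R : Ω → Matrix (Fin N) (Fin T) ℝ) (ω : Ω) (b : Fin M → Bool) : ℝ :=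
  centeredRandStat c P s b (R ω) / sigma μ c P s R

/-- The `K`-th unconditional moment `μ_K = E[Δ ^ K]`. -/
def moment {Ω : Type*} [MeasurableSpace Ω] (μ : Measure Ω) (c : Fin N → Fin M)
    (P : Matrix (Fin T) (Fin T) ℝ) (s : Matrix (Fin N) (Fin N) ℝ)
    (R : Ω → Matrix (Fin N) (Fin T) ℝ) (K : ℕ) : ℝ :=
  ∫ ω, Delta μ c P s R ω ^ K ∂μ

/-- The `K`-th moment `μ̃_K = Ẽ[Δ̃ ^ K]` of the randomization distribution, a function of the
data. -/
def momentRand {Ω : Type*} [MeasurableSpace Ω] (μ : Measure Ω) (c : Fin N → Fin M)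
    (P : Matrix (Fin T) (Fin T) ℝ) (s : Matrix (Fin N) (Fin N) ℝ)
    (R : Ω → Matrix (Fin N) (Fin T) ℝ) (K : ℕ) (ω : Ω) : ℝ :=
  randExp fun b => DeltaRand μ c P s R ω b ^ K

/-- `δ_{m,m'} = ∑_{i ∈ C_m, j ∈ C_m'} s_ij R_iᵀ (I - P) R_j`. -/
def clusterDelta (c : Fin N → Fin M) (P : Matrix (Fin T) (Fin T) ℝ)
    (s : Matrix (Fin N) (Fin N) ℝ) (R : Matrix (Fin N) (Fin T) ℝ) (m m' : Fin M) : ℝ :=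
  ∑ i with c i = m, ∑ j with c j = m', s i j * (R i ⬝ᵥ ((1 - P) *ᵥ R j))

/-- `σ_δ²`, the average over the pairs `m < m'` of the variance of `δ_{m,m'} / √T`. -/
def sigmaDeltaSq {Ω : Type*} [MeasurableSpace Ω] (μ : Measure Ω) (c : Fin N → Fin M)
    (P : Matrix (Fin T) (Fin T) ℝ) (s : Matrix (Fin N) (Fin N) ℝ)
    (R : Ω → Matrix (Fin N) (Fin T) ℝ) : ℝ :=
  (1 / (M.choose 2 : ℝ)) * ∑ m : Fin M, ∑ m' : Fin M with m < m',
    variance (fun ω => (1 / √(T : ℝ)) * clusterDelta c P s (R ω) m m') μ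

/-- The weights are symmetric, and the squared weights of each pair of distinct clusters sum to
one. -/
structure IsWeight (c : Fin N → Fin M) (s : Matrix (Fin N) (Fin N) ℝ) : Prop where
  symm : ∀ i j, s i j = s j i
  normalized : ∀ m m' : Fin M, m ≠ m' → ∑ i with c i = m, ∑ j with c j = m', s i j ^ 2 = 1

end Panel

end

/-! Since `P` is a symmetric involution, `S(R̃)` splits into a part free of the coins and `∑_{m<m'}
η_m η_{m'} δ_{m,m'}` with signs `η_m = ±1`. Centering removes the first part, so `Δ` and `Δ̃` are
the normalized sums of `δ_{m,m'}` and of `η_m η_{m'} δ_{m,m'}`. Regard clusters as vertices and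
pairs of clusters as edges. Expanding `K`th powers turns `μ_K - μ̃_K`, up to normalization, into a
sum over `K`-tuples of edges of the defects `E[∏ δ] - Ẽ[∏ η] ∏ δ`
(`integral_sub_average_eq_sum_edgeDefect`), and its mean square into a sum over pairs of tuples.

The vertices carry independent centered vectors, so a product in which some vertex occurs exactly
once has mean zero. A pair of tuples that contributes therefore has at most `2K` distinct vertices.
Equality would force disjoint tuples with every vertex occurring exactly twice; but then the signs
average to one and the two defects are independent and centered. So at most `2K - 1` vertices
survive (`card_image_vert_lt`), which leaves `O(M^(2K-1))` pairs. Distinct edges are uncorrelated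
(`variance_sum_edgeForm`), so `σ^(2K)` is of order `T^K M^(2K) σ_δ^(2K)`, and the quotient is of
order `1/M`.

Each surviving pair is bounded through the moment of order `2K` of `δ_{m,m'} / √T`
(`integral_bilinear_pow_le`). With one cluster frozen this is a linear form in the errors of the
other; least squares projection does not increase its coefficients, sub-Gaussianity bounds its
moments, and Jensen's inequality with weights built from `s_ij² / T` handles the frozen cluster. -/

noncomputable section

set_option linter.unusedSectionVars false

namespace Panel

/-! ### Vertex multiplicities, tuples with few values, and averages of signs. -/

section Counting

variable {ι V : Type*} [Fintype ι] [Fintype V] [DecidableEq V]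

/-- The number of indices at which `v` takes the value `m`. -/
def mult (v : ι → V) (m : V) : ℕ := (Finset.univ.filter fun j => v j = m).card

theorem mult_eq_sum (v : ι → V) (m : V) : mult v m = ∑ j, if v j = m then 1 else 0 :=
  Finset.card_filter _ _

theorem mult_ne_zero_of_mem {v : ι → V} {m : V} (hm : m ∈ Finset.univ.image v) : mult v m ≠ 0 := by
  obtain ⟨j, -, rfl⟩ := Finset.mem_image.1 hm
  exact Finset.card_ne_zero_of_mem (Finset.mem_filter.2 ⟨Finset.mem_univ j, rfl⟩)

theorem card_eq_sum_mult (v : ι → V) :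
    Fintype.card ι = ∑ m ∈ Finset.univ.image v, mult v m :=
  Finset.card_eq_sum_card_image v Finset.univ

theorem two_mul_card_image_le (v : ι → V) (h : ∀ m, mult v m ≠ 1) :
    2 * (Finset.univ.image v).card ≤ Fintype.card ι := by
  rw [card_eq_sum_mult v, mul_comm, ← smul_eq_mul]
  refine Finset.card_nsmul_le_sum _ _ _ fun m hm => ?_
  have := h m
  have := mult_ne_zero_of_mem hm
  omega

/-- An odd multiplicity other than one is at least three, which makes the count strict. -/
theorem two_mul_card_image_lt (v : ι → V) (h : ∀ m, mult v m ≠ 1) (m₀ : V)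
    (hm₀ : Odd (mult v m₀)) : 2 * (Finset.univ.image v).card < Fintype.card ι := by
  rw [card_eq_sum_mult v, mul_comm, ← smul_eq_mul, ← Finset.sum_const]
  refine Finset.sum_lt_sum (fun m hm => ?_) ⟨m₀, ?_, ?_⟩
  · have := h m
    have := mult_ne_zero_of_mem hm
    omega
  · by_contra hc
    have : mult v m₀ = 0 := by
      rw [mult, Finset.card_eq_zero, Finset.filter_eq_empty_iff]
      exact fun j _ hj => hc (hj ▸ Finset.mem_image_of_mem v (Finset.mem_univ j))
    simp [this] at hm₀
  · have := h m₀
    obtain ⟨k, hk⟩ := hm₀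
    omega

/-- A tuple with at most `n - 1` values factors through `Fin (n - 1)`. The factor `Fintype.card V`
on the left replaces the exponent `n - 1` on the right and makes empty `V` harmless. -/
theorem card_filter_card_image_lt_mul_le [DecidableEq ι] (n : ℕ) :
    (Finset.univ.filter fun v : ι → V => (Finset.univ.image v).card < n).card * Fintype.card V
      ≤ n ^ Fintype.card ι * Fintype.card V ^ n := by
  rcases isEmpty_or_nonempty V with hV | ⟨⟨v₀⟩⟩
  · simp
  rcases n with _ | r
  · simp
  have hsub : (Finset.univ.filter fun v : ι → V => (Finset.univ.image v).card < r + 1) ⊆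
      Finset.univ.image fun q : (ι → Fin r) × (Fin r → V) => q.2 ∘ q.1 := by
    intro v hv
    rw [Finset.mem_filter] at hv
    have hc : Fintype.card (Finset.univ.image v) ≤ Fintype.card (Fin r) := by
      rw [Fintype.card_coe, Fintype.card_fin]; omega
    obtain ⟨emb⟩ := Function.Embedding.nonempty_of_card_le hc
    -- The values of `v` are labelled by `emb`, and the second map decodes the labels; `v₀` only
    -- fills unused labels.
    refine Finset.mem_image.2 ⟨(fun j => emb ⟨v j, Finset.mem_image_of_mem v (Finset.mem_univ j)⟩,
      Function.extend emb Subtype.val fun _ => v₀), Finset.mem_univ _, ?_⟩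
    funext j
    simp only [Function.comp_apply, emb.injective.extend_apply]
  have h1 := (Finset.card_le_card hsub).trans Finset.card_image_le
  rw [Finset.card_univ, Fintype.card_prod, Fintype.card_fun, Fintype.card_fun,
    Fintype.card_fin] at h1
  calc _ ≤ (r ^ Fintype.card ι * Fintype.card V ^ r) * Fintype.card V := by gcongr
    _ = r ^ Fintype.card ι * Fintype.card V ^ (r + 1) := by ring
    _ ≤ _ := by gcongr; omega

/-- The sign of a coin flip. -/
def coinSign (b : Bool) : ℝ := if b then -1 else 1

/-- The expected product of the signs of the coin flips at the indices `v`. -/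
def signMean (v : ι → V) : ℝ :=
  (∑ b : V → Bool, ∏ j, coinSign (b (v j))) / 2 ^ Fintype.card V

/-- The coins are independent, and an odd power of a fair sign averages to zero. -/
theorem signMean_eq (v : ι → V) : signMean v = ∏ m, if Even (mult v m) then (1 : ℝ) else 0 := by
  have h (b : V → Bool) : ∏ j, coinSign (b (v j)) = ∏ m, coinSign (b m) ^ mult v m := by
    rw [← Finset.prod_fiberwise_of_maps_to (s := Finset.univ) (t := Finset.univ) (g := v)
      (fun _ _ => Finset.mem_univ _)]
    refine Finset.prod_congr rfl fun m _ => ?_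
    rw [mult, ← Finset.prod_const]
    exact Finset.prod_congr rfl fun j hj => by rw [(Finset.mem_filter.1 hj).2]
  rw [signMean, Finset.sum_congr rfl fun b _ => h b]
  have h2 := Finset.prod_univ_sum (fun _ : V => (Finset.univ : Finset Bool))
    (fun m b => coinSign b ^ mult v m)
  rw [Fintype.piFinset_univ] at h2
  rw [← h2, ← Finset.card_univ, ← Finset.prod_const, ← Finset.prod_div_distrib]
  refine Finset.prod_congr rfl fun m _ => ?_
  split_ifs with he
  · simp [coinSign, he]
  · simp [coinSign, (Nat.not_even_iff_odd.1 he).neg_one_pow]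

theorem signMean_eq_zero_or_one (v : ι → V) :
    (signMean v = 0 ∧ ∃ m, Odd (mult v m)) ∨ (signMean v = 1 ∧ ∀ m, Even (mult v m)) := by
  by_cases h : ∀ m, Even (mult v m)
  · exact Or.inr ⟨by simp [signMean_eq, h], h⟩
  · obtain ⟨m, hm⟩ := not_forall.1 h
    refine Or.inl ⟨?_, m, Nat.not_even_iff_odd.1 hm⟩
    rw [signMean_eq]
    exact Finset.prod_eq_zero (Finset.mem_univ m) (if_neg hm)

end Counting

/-! ### An algebra of random variables with all moments finite. -/

section AllMoments

variable {Ω : Type*} [MeasurableSpace Ω] {μ : Measure Ω}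

/-- The random variable has finite absolute moments of all orders. -/
def HasAllMoments (f : Ω → ℝ) (μ : Measure Ω) : Prop := ∀ p : ℝ≥0∞, p ≠ ∞ → MemLp f p μ

namespace HasAllMoments

theorem integrable {f : Ω → ℝ} (h : HasAllMoments f μ) : Integrable f μ :=
  memLp_one_iff_integrable.1 (h 1 ENNReal.one_ne_top)

theorem const [IsFiniteMeasure μ] (x : ℝ) : HasAllMoments (fun _ : Ω => x) μ :=
  fun _ _ => memLp_const x

theorem mul {f g : Ω → ℝ} (hf : HasAllMoments f μ) (hg : HasAllMoments g μ) :
    HasAllMoments (fun ω => f ω * g ω) μ := by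
  intro p hp
  have h2 : 2 * p ≠ ∞ := ENNReal.mul_ne_top ENNReal.ofNat_ne_top hp
  have : ENNReal.HolderTriple (2 * p) (2 * p) p := by
    constructor
    rw [ENNReal.mul_inv (Or.inl two_ne_zero) (Or.inl ENNReal.ofNat_ne_top), ← add_mul,
      ENNReal.inv_two_add_inv_two, one_mul]
  exact (hg _ h2).mul' (hf _ h2)

theorem sub {f g : Ω → ℝ} (hf : HasAllMoments f μ) (hg : HasAllMoments g μ) :
    HasAllMoments (fun ω => f ω - g ω) μ :=
  fun p hp => (hf p hp).sub (hg p hp)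

theorem sum {ι : Type*} (s : Finset ι) {f : ι → Ω → ℝ} (hf : ∀ i ∈ s, HasAllMoments (f i) μ) :
    HasAllMoments (fun ω => ∑ i ∈ s, f i ω) μ :=
  fun p hp => memLp_finsetSum s fun i hi => hf i hi p hp

theorem prod [IsFiniteMeasure μ] {ι : Type*} (s : Finset ι) {f : ι → Ω → ℝ}
    (hf : ∀ i ∈ s, HasAllMoments (f i) μ) : HasAllMoments (fun ω => ∏ i ∈ s, f i ω) μ := by
  classical
  induction s using Finset.induction_on with
  | empty => simpa using const 1
  | insert a s ha ih =>
    simp_rw [Finset.prod_insert ha]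
    exact (hf a (by simp)).mul (ih fun i hi => hf i (by simp [hi]))

theorem pow [IsFiniteMeasure μ] {f : Ω → ℝ} (hf : HasAllMoments f μ) (n : ℕ) :
    HasAllMoments (fun ω => f ω ^ n) μ := by
  simpa using prod (Finset.range n) (f := fun _ => f) fun _ _ => hf

theorem const_mul [IsFiniteMeasure μ] {f : Ω → ℝ} (hf : HasAllMoments f μ) (x : ℝ) :
    HasAllMoments (fun ω => x * f ω) μ :=
  (const x).mul hf

theorem div_const [IsFiniteMeasure μ] {f : Ω → ℝ} (hf : HasAllMoments f μ) (x : ℝ) :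
    HasAllMoments (fun ω => f ω / x) μ := by
  simpa [div_eq_inv_mul] using hf.const_mul x⁻¹

end HasAllMoments

/-- Every factor is at most the largest one; the summand `1` serves the empty product. -/
theorem prod_le_one_add_sum_pow {K : ℕ} (x : Fin K → ℝ) (hx : ∀ k, 0 ≤ x k) :
    ∏ k, x k ≤ 1 + ∑ k, x k ^ K := by
  rcases isEmpty_or_nonempty (Fin K) with h | h
  · simp
  obtain ⟨k₀, -, hk₀⟩ := Finset.exists_max_image Finset.univ x Finset.univ_nonempty
  calc ∏ k, x k ≤ ∏ _k : Fin K, x k₀ := Finset.prod_le_prod (fun k _ => hx k) fun k _ => hk₀ k (Finset.mem_univ k)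
    _ = x k₀ ^ K := by simp
    _ ≤ ∑ k, x k ^ K := Finset.single_le_sum (f := fun k => x k ^ K)
        (fun k _ => pow_nonneg (hx k) K) (Finset.mem_univ k₀)
    _ ≤ _ := by linarith

end AllMoments

/-! ### Means of products of edge forms over independent vertices. -/

section Chaos

variable {Ω : Type*} [MeasurableSpace Ω] {V A : Type*} [Fintype V] [DecidableEq V] [Fintype A]

/-- Independent vectors `Z m`, centered and with moments of all orders. -/
structure IsIndepFamily (μ : Measure Ω) (Z : V → Bool × A → Ω → ℝ) : Prop where
  indep : iIndepFun (fun m ω x => Z m x ω) μ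
  meas : ∀ m x, Measurable (Z m x)
  moments : ∀ m x, HasAllMoments (Z m x) μ
  centered : ∀ m x, ∫ ω, Z m x ω ∂μ = 0

/-- The bilinear form in the vectors of two vertices, with the weight `θ`. -/
def edgeForm (θ : V × V → ℝ) (Z : V → Bool × A → Ω → ℝ) (p : V × V) (ω : Ω) : ℝ :=
  θ p * ∑ a, Z p.1 (false, a) ω * Z p.2 (true, a) ω

/-- The endpoints of a family of edges. -/
def vert {ι : Type*} (e : ι → V × V) (j : ι × Bool) : V := if j.2 then (e j.1).2 else (e j.1).1

variable {μ : Measure Ω} [IsProbabilityMeasure μ] {θ : V × V → ℝ} {Z : V → Bool × A → Ω → ℝ}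

theorem IsIndepFamily.hasAllMoments_edgeForm (hZ : IsIndepFamily μ Z) (p : V × V) :
    HasAllMoments (edgeForm θ Z p) μ :=
  (HasAllMoments.sum _ fun _ _ => (hZ.moments _ _).mul (hZ.moments _ _)).const_mul _

theorem IsIndepFamily.hasAllMoments_prod_edgeForm (hZ : IsIndepFamily μ Z) {ι : Type*} [Fintype ι]
    (e : ι → V × V) : HasAllMoments (fun ω => ∏ k, edgeForm θ Z (e k) ω) μ :=
  HasAllMoments.prod _ fun _ _ => hZ.hasAllMoments_edgeForm _

/-- The expectation of a monomial factors over the vertices. -/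
theorem IsIndepFamily.integral_monomial (hZ : IsIndepFamily μ Z) {J : Type*} [Fintype J]
    (v : J → V) (x : J → Bool × A) :
    ∫ ω, ∏ j, Z (v j) (x j) ω ∂μ
      = ∏ m, ∫ ω, ∏ j, (if v j = m then Z m (x j) ω else 1) ∂μ := by
  have h := hZ.indep.integral_fun_prod_comp (𝕜 := ℝ)
    (f := fun m z => ∏ j, if v j = m then z (x j) else 1)
    (fun m => (measurable_pi_lambda _ fun y => hZ.meas m y).aemeasurable)
    (fun m => (Finset.measurable_fun_prod _ fun j _ => by
      split_ifs <;> fun_prop).aestronglyMeasurable)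
  rw [← h]
  refine integral_congr_ae (Filter.Eventually.of_forall fun ω => ?_)
  simp only
  rw [Finset.prod_comm]
  exact Finset.prod_congr rfl fun j _ => by simp

theorem IsIndepFamily.integral_monomial_eq_zero (hZ : IsIndepFamily μ Z) {J : Type*} [Fintype J]
    (v : J → V) (x : J → Bool × A) (m : V) (hm : mult v m = 1) :
    ∫ ω, ∏ j, Z (v j) (x j) ω ∂μ = 0 := by
  rw [hZ.integral_monomial]
  refine Finset.prod_eq_zero (Finset.mem_univ m) ?_
  obtain ⟨j₀, hj₀⟩ := Finset.card_eq_one.1 hm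
  have h (ω : Ω) : ∏ j, (if v j = m then Z m (x j) ω else 1) = Z m (x j₀) ω := by
    rw [← Finset.prod_filter, hj₀, Finset.prod_singleton]
  simp_rw [h]
  exact hZ.centered m _

theorem IsIndepFamily.integral_monomial_mul (hZ : IsIndepFamily μ Z) {J J' : Type*} [Fintype J]
    [Fintype J'] (v : J → V) (v' : J' → V) (x : J → Bool × A) (x' : J' → Bool × A)
    (hd : ∀ j j', v j ≠ v' j') :
    ∫ ω, (∏ j, Z (v j) (x j) ω) * ∏ j, Z (v' j) (x' j) ω ∂μ
      = (∫ ω, ∏ j, Z (v j) (x j) ω ∂μ) * ∫ ω, ∏ j, Z (v' j) (x' j) ω ∂μ := by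
  -- Concatenating the monomials reduces the claim to one vertex at a time, where one of the two
  -- factors is trivial.
  have h := hZ.integral_monomial (Sum.elim v v') (Sum.elim x x')
  simp only [Fintype.prod_sum_type, Sum.elim_inl, Sum.elim_inr] at h
  rw [h, hZ.integral_monomial v x, hZ.integral_monomial v' x', ← Finset.prod_mul_distrib]
  refine Finset.prod_congr rfl fun m _ => ?_
  by_cases hm : ∃ j, v j = m
  · obtain ⟨j, rfl⟩ := hm
    simp [fun j' => (hd j j').symm]
    rfl
  · push Not at hm
    simp [hm]
    rfl

theorem prod_edgeForm_eq {ι : Type*} [Fintype ι] [DecidableEq ι] (e : ι → V × V) (ω : Ω) :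
    ∏ k, edgeForm θ Z (e k) ω = (∏ k, θ (e k)) *
      ∑ α : ι → A, ∏ j : ι × Bool, Z (vert e j) (j.2, α j.1) ω := by
  simp only [edgeForm, Finset.prod_mul_distrib]
  congr 1
  rw [Finset.prod_univ_sum, Fintype.piFinset_univ]
  refine Finset.sum_congr rfl fun α _ => ?_
  rw [Fintype.prod_prod_type]
  exact Finset.prod_congr rfl fun k _ => by simp [vert, mul_comm]

theorem IsIndepFamily.hasAllMoments_monomial (hZ : IsIndepFamily μ Z) {J : Type*} [Fintype J]
    (v : J → V) (x : J → Bool × A) : HasAllMoments (fun ω => ∏ j, Z (v j) (x j) ω) μ :=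
  HasAllMoments.prod _ fun _ _ => hZ.moments _ _

theorem IsIndepFamily.integral_prod_edgeForm (hZ : IsIndepFamily μ Z) {ι : Type*} [Fintype ι]
    [DecidableEq ι] (e : ι → V × V) :
    ∫ ω, ∏ k, edgeForm θ Z (e k) ω ∂μ = (∏ k, θ (e k)) *
      ∑ α : ι → A, ∫ ω, ∏ j : ι × Bool, Z (vert e j) (j.2, α j.1) ω ∂μ := by
  simp_rw [prod_edgeForm_eq]
  rw [integral_const_mul, integral_finsetSum]
  exact fun α _ => (hZ.hasAllMoments_monomial _ _).integrable

theorem IsIndepFamily.integral_prod_edgeForm_eq_zero (hZ : IsIndepFamily μ Z) {ι : Type*}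
    [Fintype ι] (e : ι → V × V) (m : V) (hm : mult (vert e) m = 1) :
    ∫ ω, ∏ k, edgeForm θ Z (e k) ω ∂μ = 0 := by
  classical
  rw [hZ.integral_prod_edgeForm, Finset.sum_eq_zero, mul_zero]
  exact fun α _ => hZ.integral_monomial_eq_zero _ _ m hm

theorem IsIndepFamily.integral_prod_edgeForm_mul (hZ : IsIndepFamily μ Z) {ι : Type*}
    [Fintype ι] (e e' : ι → V × V) (hd : ∀ j j', vert e j ≠ vert e' j') :
    ∫ ω, (∏ k, edgeForm θ Z (e k) ω) * ∏ k, edgeForm θ Z (e' k) ω ∂μ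
      = (∫ ω, ∏ k, edgeForm θ Z (e k) ω ∂μ) * ∫ ω, ∏ k, edgeForm θ Z (e' k) ω ∂μ := by
  classical
  rw [hZ.integral_prod_edgeForm, hZ.integral_prod_edgeForm]
  simp_rw [prod_edgeForm_eq, mul_mul_mul_comm, Finset.sum_mul_sum]
  rw [integral_const_mul, integral_finsetSum]
  · congr 1
    refine Finset.sum_congr rfl fun α _ => ?_
    rw [integral_finsetSum]
    · exact Finset.sum_congr rfl fun α' _ => hZ.integral_monomial_mul _ _ _ _ hd
    · exact fun α' _ =>
        ((hZ.hasAllMoments_monomial _ _).mul (hZ.hasAllMoments_monomial _ _)).integrable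
  · exact fun α _ => (HasAllMoments.sum _ fun α' _ =>
        (hZ.hasAllMoments_monomial _ _).mul (hZ.hasAllMoments_monomial _ _)).integrable

end Chaos

/-! ### The mean square of the sum of edge defects. -/

section ChaosBound

variable {Ω : Type*} [MeasurableSpace Ω] {V A : Type*} [Fintype V] [DecidableEq V] [Fintype A]
  {μ : Measure Ω} [IsProbabilityMeasure μ] {θ : V × V → ℝ} {Z : V → Bool × A → Ω → ℝ}

theorem image_vert_sumElim {ι ι' : Type*} [Fintype ι] [Fintype ι'] (e : ι → V × V)
    (e' : ι' → V × V) : Finset.univ.image (vert (Sum.elim e e'))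
      = Finset.univ.image (vert e) ∪ Finset.univ.image (vert e') := by
  ext m
  simp only [Finset.mem_image, Finset.mem_union, Finset.mem_univ, true_and, Prod.exists,
    Sum.exists]
  rfl

/-- The mean of an edge monomial minus its average over the coin flips. -/
def edgeDefect (μ : Measure Ω) (θ : V × V → ℝ) (Z : V → Bool × A → Ω → ℝ) {ι : Type*} [Fintype ι]
    (e : ι → V × V) (ω : Ω) : ℝ :=
  (∫ ω', ∏ k, edgeForm θ Z (e k) ω' ∂μ) - signMean (vert e) * ∏ k, edgeForm θ Z (e k) ω

theorem IsIndepFamily.hasAllMoments_edgeDefect (hZ : IsIndepFamily μ Z) {ι : Type*} [Fintype ι]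
    (e : ι → V × V) : HasAllMoments (edgeDefect μ θ Z e) μ :=
  (HasAllMoments.const _).sub ((hZ.hasAllMoments_prod_edgeForm e).const_mul _)

theorem IsIndepFamily.integral_edgeDefect_mul (hZ : IsIndepFamily μ Z) {ι ι' : Type*} [Fintype ι]
    [Fintype ι'] (e : ι → V × V) (e' : ι' → V × V) :
    ∫ ω, edgeDefect μ θ Z e ω * edgeDefect μ θ Z e' ω ∂μ
      = (∫ ω, ∏ k, edgeForm θ Z (e k) ω ∂μ) * (∫ ω, ∏ k, edgeForm θ Z (e' k) ω ∂μ)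
          * (1 - signMean (vert e) - signMean (vert e'))
        + signMean (vert e) * signMean (vert e')
          * ∫ ω, (∏ k, edgeForm θ Z (e k) ω) * ∏ k, edgeForm θ Z (e' k) ω ∂μ := by
  have hG := hZ.hasAllMoments_prod_edgeForm (θ := θ) e
  have hG' := hZ.hasAllMoments_prod_edgeForm (θ := θ) e'
  unfold edgeDefect
  set G := fun ω => ∏ k, edgeForm θ Z (e k) ω
  set G' := fun ω => ∏ k, edgeForm θ Z (e' k) ω
  set x := signMean (vert e)
  set y := signMean (vert e')
  have h (ω : Ω) : ((∫ ω, G ω ∂μ) - x * G ω) * ((∫ ω, G' ω ∂μ) - y * G' ω)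
      = ((∫ ω, G ω ∂μ) * (∫ ω, G' ω ∂μ) - (x * ∫ ω, G' ω ∂μ) * G ω)
        - ((y * ∫ ω, G ω ∂μ) * G' ω - (x * y) * (G ω * G' ω)) := by ring
  have h1 := hG.const_mul (x * ∫ ω, G' ω ∂μ)
  have h2 := hG'.const_mul (y * ∫ ω, G ω ∂μ)
  have h3 := (hG.mul hG').const_mul (x * y)
  have h0 : HasAllMoments (fun _ => (∫ ω, G ω ∂μ) * (∫ ω, G' ω ∂μ)) μ := HasAllMoments.const _
  refine (integral_congr_ae (Filter.Eventually.of_forall h)).trans ?_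
  rw [integral_sub (h0.sub h1).integrable (h2.sub h3).integrable,
    integral_sub h0.integrable h1.integrable, integral_sub h2.integrable h3.integrable,
    integral_const, integral_const_mul, integral_const_mul, integral_const_mul]
  simp only [probReal_univ, one_smul]
  ring

/-- This is the source of the factor `1/M`: of the `4K` endpoints of a contributing pair, at most
`2K - 1` are distinct. -/
theorem IsIndepFamily.card_image_vert_lt (hZ : IsIndepFamily μ Z) {K : ℕ} (e e' : Fin K → V × V)
    (h : ∫ ω, edgeDefect μ θ Z e ω * edgeDefect μ θ Z e' ω ∂μ ≠ 0) :
    (Finset.univ.image (vert (Sum.elim e e'))).card < 2 * K := by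
  rw [image_vert_sumElim]
  have hcard : Fintype.card (Fin K × Bool) = 2 * K := by simp [mul_comm]
  have heven {v : Fin K × Bool → V} (hv : ∀ m, Even (mult v m)) (m : V) : mult v m ≠ 1 :=
    fun h1 => by simpa [h1] using hv m
  have hone (e : Fin K → V × V) (he : ∫ ω, ∏ k, edgeForm θ Z (e k) ω ∂μ ≠ 0) (m : V) :
      mult (vert e) m ≠ 1 := fun hm => he (hZ.integral_prod_edgeForm_eq_zero e m hm)
  by_cases hd : ∀ j j', vert e j ≠ vert e' j'
  · have hu := Finset.card_union_le (Finset.univ.image (vert e)) (Finset.univ.image (vert e'))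
    rw [hZ.integral_edgeDefect_mul, hZ.integral_prod_edgeForm_mul e e' hd] at h
    -- For disjoint tuples the defects are independent, so the integral is the product of their
    -- means; each mean vanishes unless some multiplicity is odd, hence at least three.
    have hfac : (1 - signMean (vert e)) * (1 - signMean (vert e'))
        * ((∫ ω, ∏ k, edgeForm θ Z (e k) ω ∂μ) * ∫ ω, ∏ k, edgeForm θ Z (e' k) ω ∂μ) ≠ 0 := by
      convert h using 1; ring
    have hlt (e : Fin K → V × V) (h1 : 1 - signMean (vert e) ≠ 0)
        (h2 : ∫ ω, ∏ k, edgeForm θ Z (e k) ω ∂μ ≠ 0) :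
        2 * (Finset.univ.image (vert e)).card < 2 * K := by
      rcases signMean_eq_zero_or_one (vert e) with ⟨-, m, hm⟩ | ⟨h3, -⟩
      · exact hcard ▸ two_mul_card_image_lt _ (hone e h2) m hm
      · simp [h3] at h1
    have h1 := hlt e (left_ne_zero_of_mul (left_ne_zero_of_mul hfac))
      (left_ne_zero_of_mul (right_ne_zero_of_mul hfac))
    have h2 := hlt e' (right_ne_zero_of_mul (left_ne_zero_of_mul hfac))
      (right_ne_zero_of_mul (right_ne_zero_of_mul hfac))
    omega
  · push Not at hd
    obtain ⟨j, j', hj⟩ := hd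
    have hinter : (Finset.univ.image (vert e) ∩ Finset.univ.image (vert e')).card ≠ 0 :=
      Finset.card_ne_zero_of_mem (Finset.mem_inter.2
        ⟨Finset.mem_image_of_mem _ (Finset.mem_univ j),
          hj ▸ Finset.mem_image_of_mem _ (Finset.mem_univ j')⟩)
    have hu := Finset.card_union_add_card_inter (Finset.univ.image (vert e))
      (Finset.univ.image (vert e'))
    -- With a shared vertex, at most `K` vertices per tuple already suffice. If a mean vanishes,
    -- only the term carrying both sign averages is left, and it forces all multiplicities to be
    -- even.
    have hle : (∀ m, mult (vert e) m ≠ 1) ∧ ∀ m, mult (vert e') m ≠ 1 := by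
      rw [hZ.integral_edgeDefect_mul] at h
      by_cases h0 : (∫ ω, ∏ k, edgeForm θ Z (e k) ω ∂μ)
          * (∫ ω, ∏ k, edgeForm θ Z (e' k) ω ∂μ) = 0
      · rw [h0, zero_mul, zero_add] at h
        have h1 := left_ne_zero_of_mul h
        rcases signMean_eq_zero_or_one (vert e) with h2 | h2
        · simp [h2.1] at h1
        rcases signMean_eq_zero_or_one (vert e') with h3 | h3
        · simp [h3.1] at h1
        exact ⟨heven h2.2, heven h3.2⟩
      · exact ⟨hone e (left_ne_zero_of_mul h0), hone e' (right_ne_zero_of_mul h0)⟩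
    have h1 := two_mul_card_image_le _ hle.1
    have h2 := two_mul_card_image_le _ hle.2
    omega

theorem sq_integral_le {f : Ω → ℝ} (hf : HasAllMoments f μ) :
    (∫ ω, f ω ∂μ) ^ 2 ≤ ∫ ω, f ω ^ 2 ∂μ := by
  have h := variance_nonneg f μ
  rw [variance_eq_sub (hf 2 ENNReal.ofNat_ne_top)] at h
  simpa using sub_nonneg.1 h

theorem abs_integral_mul_le {f g : Ω → ℝ} (hf : HasAllMoments f μ) (hg : HasAllMoments g μ) {B : ℝ}
    (hfB : ∫ ω, f ω ^ 2 ∂μ ≤ B) (hgB : ∫ ω, g ω ^ 2 ∂μ ≤ B) : |∫ ω, f ω * g ω ∂μ| ≤ B := by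
  have h2 : ∫ ω, |f ω * g ω| ∂μ ≤ ∫ ω, (f ω ^ 2 + g ω ^ 2) / 2 ∂μ := by
    refine integral_mono (hf.mul hg).integrable.abs
      (((hf.pow 2).integrable.add (hg.pow 2).integrable).div_const 2) fun ω => ?_
    simp only [abs_mul]
    nlinarith [sq_nonneg (|f ω| - |g ω|), sq_abs (f ω), sq_abs (g ω)]
  rw [integral_div, integral_add (hf.pow 2).integrable (hg.pow 2).integrable] at h2
  have := abs_integral_le_integral_abs (f := fun ω => f ω * g ω) (μ := μ)
  linarith

/-- The sign averages are `0` or `1`; the factor `2` is needed only when both are `1`, where the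
integral is a covariance. -/
theorem IsIndepFamily.abs_integral_edgeDefect_mul_le (hZ : IsIndepFamily μ Z) {K : ℕ}
    (e e' : Fin K → V × V) {B : ℝ}
    (hB : ∀ e : Fin K → V × V, ∫ ω, (∏ k, edgeForm θ Z (e k) ω) ^ 2 ∂μ ≤ B) :
    |∫ ω, edgeDefect μ θ Z e ω * edgeDefect μ θ Z e' ω ∂μ| ≤ 2 * B := by
  rw [hZ.integral_edgeDefect_mul]
  have hG := hZ.hasAllMoments_prod_edgeForm (θ := θ) e
  have hG' := hZ.hasAllMoments_prod_edgeForm (θ := θ) e'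
  have h1 := abs_le.1 (abs_integral_mul_le hG hG' (hB e) (hB e'))
  have h2 := (sq_integral_le hG).trans (hB e)
  have h3 := (sq_integral_le hG').trans (hB e')
  set x := ∫ ω, ∏ k, edgeForm θ Z (e k) ω ∂μ
  set y := ∫ ω, ∏ k, edgeForm θ Z (e' k) ω ∂μ
  have h4 : x * y ≤ B := by nlinarith [sq_nonneg (x - y)]
  have h5 : -B ≤ x * y := by nlinarith [sq_nonneg (x + y)]
  rw [abs_le]
  rcases signMean_eq_zero_or_one (vert e) with ⟨ha, -⟩ | ⟨ha, -⟩ <;>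
    rcases signMean_eq_zero_or_one (vert e') with ⟨hb, -⟩ | ⟨hb, -⟩ <;>
    rw [ha, hb] <;> constructor <;> linarith [h1.1, h1.2]

theorem IsIndepFamily.integral_prod_edgeForm_sq_le (hZ : IsIndepFamily μ Z) {K : ℕ} {B : ℝ}
    (hB : ∀ p, ∫ ω, edgeForm θ Z p ω ^ (2 * K) ∂μ ≤ B) (e : Fin K → V × V) :
    ∫ ω, (∏ k, edgeForm θ Z (e k) ω) ^ 2 ∂μ ≤ 1 + K * B := by
  have hm (k : Fin K) : Integrable (fun ω => edgeForm θ Z (e k) ω ^ (2 * K)) μ :=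
    ((hZ.hasAllMoments_edgeForm (e k)).pow _).integrable
  have hs : Integrable (fun ω => ∑ k, edgeForm θ Z (e k) ω ^ (2 * K)) μ :=
    integrable_finsetSum _ fun k _ => hm k
  calc ∫ ω, (∏ k, edgeForm θ Z (e k) ω) ^ 2 ∂μ
      ≤ ∫ ω, (1 + ∑ k, edgeForm θ Z (e k) ω ^ (2 * K)) ∂μ := by
        refine integral_mono ((hZ.hasAllMoments_prod_edgeForm e).pow 2).integrable
          ((integrable_const 1).add hs) fun ω => ?_
        simp only [← Finset.prod_pow, pow_mul]
        exact prod_le_one_add_sum_pow _ fun k => sq_nonneg _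
    _ = 1 + ∑ k, ∫ ω, edgeForm θ Z (e k) ω ^ (2 * K) ∂μ := by
        rw [integral_add (integrable_const 1) hs, integral_finsetSum _ fun k _ => hm k]
        simp
    _ ≤ 1 + ∑ _k : Fin K, B := by gcongr with k; exact hB _
    _ = 1 + K * B := by simp

theorem prod_coinSign_vert {ι : Type*} [Fintype ι] (e : ι → V × V) (b : V → Bool) :
    ∏ j, coinSign (b (vert e j)) = ∏ k, coinSign (b (e k).1) * coinSign (b (e k).2) := by
  rw [Fintype.prod_prod_type]
  exact Finset.prod_congr rfl fun k _ => by simp [vert, mul_comm]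

/-- The mean of a power of the sum over the edges minus its average over the coin flips. -/
theorem IsIndepFamily.integral_sub_average_eq_sum_edgeDefect (hZ : IsIndepFamily μ Z) (K : ℕ)
    (ω : Ω) :
    (∫ ω', (∑ p, edgeForm θ Z p ω') ^ K ∂μ) - (∑ b : V → Bool,
        (∑ p : V × V, coinSign (b p.1) * coinSign (b p.2) * edgeForm θ Z p ω) ^ K)
          / 2 ^ Fintype.card V
      = ∑ e : Fin K → V × V, edgeDefect μ θ Z e ω := by
  simp only [Fintype.sum_pow, edgeDefect, Finset.sum_sub_distrib]
  rw [integral_finsetSum _ fun e _ => (hZ.hasAllMoments_prod_edgeForm e).integrable]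
  congr 1
  rw [Finset.sum_comm, Finset.sum_div]
  refine Finset.sum_congr rfl fun e _ => ?_
  rw [signMean, div_mul_eq_mul_div, Finset.sum_mul]
  congr 1
  refine Finset.sum_congr rfl fun b _ => ?_
  rw [prod_coinSign_vert, ← Finset.prod_mul_distrib]

theorem IsIndepFamily.integral_sum_edgeDefect_sq_le (hZ : IsIndepFamily μ Z) (K : ℕ) {B : ℝ}
    (hB : ∀ p, ∫ ω, edgeForm θ Z p ω ^ (2 * K) ∂μ ≤ B) (hB0 : 0 ≤ B) :
    (∫ ω, (∑ e : Fin K → V × V, edgeDefect μ θ Z e ω) ^ 2 ∂μ) * Fintype.card V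
      ≤ 2 * (1 + K * B) * ((2 * K : ℕ) ^ (4 * K) * (Fintype.card V : ℝ) ^ (2 * K)) := by
  set S := Finset.univ.filter fun q : (Fin K → V × V) × (Fin K → V × V) =>
    (Finset.univ.image (vert (Sum.elim q.1 q.2))).card < 2 * K
  have hcount : S.card * Fintype.card V ≤ (2 * K) ^ (4 * K) * Fintype.card V ^ (2 * K) := by
    have h1 := card_filter_card_image_lt_mul_le (ι := (Fin K ⊕ Fin K) × Bool) (V := V) (2 * K)
    have hc : Fintype.card ((Fin K ⊕ Fin K) × Bool) = 4 * K := by simp; ring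
    rw [hc] at h1
    refine le_trans (Nat.mul_le_mul_right _ ?_) h1
    -- A pair of `K`-tuples of edges is determined by its list of `4K` endpoints.
    refine Finset.card_le_card_of_injOn (fun q => vert (Sum.elim q.1 q.2)) ?_ ?_
    · intro q hq
      have := (Finset.mem_filter.1 hq).2
      simpa using this
    · intro q _ q' _ hqq
      refine Prod.ext (funext fun k => Prod.ext ?_ ?_) (funext fun k => Prod.ext ?_ ?_)
      · exact congrFun hqq (Sum.inl k, false)
      · exact congrFun hqq (Sum.inl k, true)
      · exact congrFun hqq (Sum.inr k, false)
      · exact congrFun hqq (Sum.inr k, true)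
  have hint : ∫ ω, (∑ e : Fin K → V × V, edgeDefect μ θ Z e ω) ^ 2 ∂μ
      = ∑ q : (Fin K → V × V) × (Fin K → V × V),
        ∫ ω, edgeDefect μ θ Z q.1 ω * edgeDefect μ θ Z q.2 ω ∂μ := by
    rw [← integral_finsetSum]
    · refine integral_congr_ae (Filter.Eventually.of_forall fun ω => ?_)
      simp only [sq, Finset.sum_mul_sum, Fintype.sum_prod_type]
    · exact fun q _ =>
        ((hZ.hasAllMoments_edgeDefect _).mul (hZ.hasAllMoments_edgeDefect _)).integrable
  have hle : ∫ ω, (∑ e : Fin K → V × V, edgeDefect μ θ Z e ω) ^ 2 ∂μ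
      ≤ S.card * (2 * (1 + K * B)) := by
    rw [hint, ← nsmul_eq_mul, ← Finset.sum_const, ← Finset.sum_subset (Finset.subset_univ S)]
    · refine Finset.sum_le_sum fun q _ => (le_abs_self _).trans ?_
      exact hZ.abs_integral_edgeDefect_mul_le _ _ (hZ.integral_prod_edgeForm_sq_le hB)
    · intro q _ hq
      by_contra hne
      exact hq (Finset.mem_filter.2 ⟨Finset.mem_univ _, hZ.card_image_vert_lt _ _ hne⟩)
  have hcount' : (S.card : ℝ) * Fintype.card V
      ≤ (2 * K : ℕ) ^ (4 * K) * (Fintype.card V : ℝ) ^ (2 * K) := by exact_mod_cast hcount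
  have hpos : 0 ≤ 2 * (1 + K * B) := by positivity
  calc _ ≤ S.card * (2 * (1 + K * B)) * Fintype.card V := by gcongr
    _ = 2 * (1 + K * B) * (S.card * Fintype.card V) := by ring
    _ ≤ _ := by gcongr

end ChaosBound

/-! ### Moments of linear forms in sub-Gaussian errors. -/

section SubGaussian

variable {N T : ℕ} {Ω : Type*} [MeasurableSpace Ω] {μ : Measure Ω} [IsProbabilityMeasure μ]
  {ε : Ω → Matrix (Fin N) (Fin T) ℝ} {κ : ℝ}

theorem trace_transpose_mul_eq_sum (A E : Matrix (Fin N) (Fin T) ℝ) :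
    (Aᵀ * E).trace = ∑ i, ∑ t, A i t * E i t := by
  simp only [Matrix.trace, Matrix.diag, Matrix.mul_apply, Matrix.transpose_apply]
  exact Finset.sum_comm

theorem measurable_trace (hε : ∀ i t, Measurable fun ω => ε ω i t) (A : Matrix (Fin N) (Fin T) ℝ) :
    Measurable fun ω => (Aᵀ * ε ω).trace := by
  simp_rw [trace_transpose_mul_eq_sum]
  fun_prop

/-- The defining set is upward closed. Adding one avoids asking whether the infimum is attained or
positive, while the constant still depends on the norm alone. -/
theorem luxemburgNorm_add_one_mem (h : IsSubGaussian μ ε) :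
    luxemburgNorm μ ε + 1 ∈ luxemburgSet μ ε := by
  obtain ⟨κ₀, hκ₀, hlt⟩ := exists_lt_of_csInf_lt h (lt_add_one (luxemburgNorm μ ε))
  have h0 := hκ₀.1
  refine ⟨h0.trans hlt, fun A hA => le_trans (lintegral_mono fun ω => ?_) (hκ₀.2 A hA)⟩
  gcongr

theorem hasAllMoments_of_integrable_pow {f : Ω → ℝ} (hf : AEStronglyMeasurable f μ)
    (h : ∀ p : ℕ, Integrable (fun ω => f ω ^ (2 * p)) μ) : HasAllMoments f μ := by
  intro p hp
  obtain ⟨n, hn⟩ := ENNReal.exists_nat_gt hp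
  have hle : p ≤ ((2 * (n + 1) : ℕ) : ℝ≥0∞) :=
    hn.le.trans (by exact_mod_cast (by omega : n ≤ 2 * (n + 1)))
  refine MemLp.mono_exponent ?_ hle
  rw [← integrable_norm_rpow_iff hf (by simp) (ENNReal.natCast_ne_top _)]
  refine (h (n + 1)).congr (Filter.Eventually.of_forall fun ω => ?_)
  simp only [ENNReal.toReal_natCast, Real.rpow_natCast, Real.norm_eq_abs, pow_mul, sq_abs]

theorem integrable_and_integral_pow_le_of_norm_one (hε : ∀ i t, Measurable fun ω => ε ω i t)
    (hκ : κ ∈ luxemburgSet μ ε) (A : Matrix (Fin N) (Fin T) ℝ) (hA : ∑ i, ∑ t, A i t ^ 2 = 1)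
    (p : ℕ) : Integrable (fun ω => (Aᵀ * ε ω).trace ^ (2 * p)) μ ∧
      ∫ ω, (Aᵀ * ε ω).trace ^ (2 * p) ∂μ ≤ 2 * p.factorial * κ ^ (2 * p) := by
  have hm := measurable_trace hε A
  set x := fun ω => (Aᵀ * ε ω).trace
  have hκ0 := hκ.1
  have hle := hκ.2 A hA
  have hmexp : Measurable fun ω => Real.exp (x ω ^ 2 / κ ^ 2) := by fun_prop
  have hint : Integrable (fun ω => Real.exp (x ω ^ 2 / κ ^ 2)) μ := by
    refine ⟨hmexp.aestronglyMeasurable, ?_⟩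
    rw [hasFiniteIntegral_iff_ofReal (Filter.Eventually.of_forall fun ω => (Real.exp_pos _).le)]
    exact hle.trans_lt (by simp)
  have hint2 : ∫ ω, Real.exp (x ω ^ 2 / κ ^ 2) ∂μ ≤ 2 := by
    rw [integral_eq_lintegral_of_nonneg_ae
      (Filter.Eventually.of_forall fun ω => (Real.exp_pos _).le) hmexp.aestronglyMeasurable]
    exact ENNReal.toReal_le_of_le_ofReal (by norm_num) (by simpa using hle)
  -- This is `y^p / p! ≤ exp y` at `y = x² / κ²`.
  have hpt (ω : Ω) : x ω ^ (2 * p) ≤ p.factorial * κ ^ (2 * p) * Real.exp (x ω ^ 2 / κ ^ 2) := by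
    have h1 := Real.pow_div_factorial_le_exp (x := x ω ^ 2 / κ ^ 2) (by positivity) p
    rw [div_pow, div_div, div_le_iff₀ (by positivity), ← pow_mul, ← pow_mul] at h1
    linarith
  have hint3 : Integrable (fun ω => x ω ^ (2 * p)) μ := by
    refine (hint.const_mul (p.factorial * κ ^ (2 * p))).mono' (hm.pow_const _).aestronglyMeasurable
      (Filter.Eventually.of_forall fun ω => ?_)
    rw [Real.norm_eq_abs, abs_of_nonneg (by rw [pow_mul]; positivity)]
    exact hpt ω
  refine ⟨hint3, ?_⟩
  calc _ ≤ ∫ ω, p.factorial * κ ^ (2 * p) * Real.exp (x ω ^ 2 / κ ^ 2) ∂μ :=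
        integral_mono hint3 (hint.const_mul _) hpt
    _ = p.factorial * κ ^ (2 * p) * ∫ ω, Real.exp (x ω ^ 2 / κ ^ 2) ∂μ := integral_const_mul _ _
    _ ≤ p.factorial * κ ^ (2 * p) * 2 := by gcongr
    _ = _ := by ring

theorem integrable_and_integral_pow_le (hε : ∀ i t, Measurable fun ω => ε ω i t)
    (hκ : κ ∈ luxemburgSet μ ε) (A : Matrix (Fin N) (Fin T) ℝ) (p : ℕ) :
    Integrable (fun ω => (Aᵀ * ε ω).trace ^ (2 * p)) μ ∧
      ∫ ω, (Aᵀ * ε ω).trace ^ (2 * p) ∂μ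
        ≤ 2 * p.factorial * κ ^ (2 * p) * (∑ i, ∑ t, A i t ^ 2) ^ p := by
  set q := ∑ i, ∑ t, A i t ^ 2 with hq
  have hκ0 := hκ.1
  have hq0 : 0 ≤ q := by positivity
  rcases hq0.eq_or_lt with h0 | h0
  · have hA (i : Fin N) (t : Fin T) : A i t = 0 := by
      have h1 := (Finset.sum_eq_zero_iff_of_nonneg (fun i _ => by positivity)).1
        (hq.symm.trans h0.symm) i (Finset.mem_univ i)
      have h2 := (Finset.sum_eq_zero_iff_of_nonneg (fun t _ => by positivity)).1 h1 t
        (Finset.mem_univ t)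
      exact pow_eq_zero_iff two_ne_zero |>.1 h2
    simp only [trace_transpose_mul_eq_sum, hA, zero_mul, Finset.sum_const_zero]
    refine ⟨integrable_const _, ?_⟩
    rcases p with _ | p
    · simp
    · simp [← h0]
  · have hs : 0 < √q := Real.sqrt_pos.2 h0
    have hs2 : √q ^ 2 = q := Real.sq_sqrt hq0
    have hnorm : ∑ i, ∑ t, ((√q)⁻¹ • A) i t ^ 2 = 1 := by
      simp only [Matrix.smul_apply, smul_eq_mul, mul_pow, ← Finset.mul_sum]
      rw [← hq, inv_pow, hs2, inv_mul_cancel₀ h0.ne']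
    obtain ⟨h1, h2⟩ := integrable_and_integral_pow_le_of_norm_one hε hκ _ hnorm p
    have h3 (ω : Ω) : (Aᵀ * ε ω).trace ^ (2 * p)
        = q ^ p * (((√q)⁻¹ • A)ᵀ * ε ω).trace ^ (2 * p) := by
      rw [Matrix.transpose_smul, Matrix.smul_mul, Matrix.trace_smul, smul_eq_mul, mul_pow, inv_pow,
        pow_mul (√q), hs2, mul_inv_cancel_left₀ (pow_pos h0 p).ne']
    simp_rw [h3]
    refine ⟨h1.const_mul _, ?_⟩
    rw [integral_const_mul, mul_comm]
    gcongr

theorem hasAllMoments_trace (hε : ∀ i t, Measurable fun ω => ε ω i t)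
    (hκ : κ ∈ luxemburgSet μ ε) (A : Matrix (Fin N) (Fin T) ℝ) :
    HasAllMoments (fun ω => (Aᵀ * ε ω).trace) μ :=
  hasAllMoments_of_integrable_pow (measurable_trace hε A).aestronglyMeasurable fun p =>
    (integrable_and_integral_pow_le hε hκ A p).1

theorem integral_trace_eq_zero (h : IsMeanZero μ ε) (A : Matrix (Fin N) (Fin T) ℝ) :
    ∫ ω, (Aᵀ * ε ω).trace ∂μ = 0 := by
  simp_rw [trace_transpose_mul_eq_sum]
  have hint (i : Fin N) (t : Fin T) : Integrable (fun ω => A i t * ε ω i t) μ :=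
    (h i t).1.const_mul (A i t)
  rw [integral_finsetSum _ fun i _ => integrable_finsetSum _ fun t _ => hint i t]
  refine Finset.sum_eq_zero fun i _ => ?_
  rw [integral_finsetSum _ fun t _ => hint i t]
  exact Finset.sum_eq_zero fun t _ => by rw [integral_const_mul, (h i t).2, mul_zero]

end SubGaussian

/-! ### Cluster residuals as linear forms in the errors. -/

section Residuals

variable {N T M D : ℕ} (c : Fin N → Fin M) (P : Matrix (Fin T) (Fin T) ℝ)
  (X : Fin D → Matrix (Fin N) (Fin T) ℝ)

theorem mosaicResid_add_covariates (β : Fin D → ℝ) (E : Matrix (Fin N) (Fin T) ℝ) :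
    mosaicResid c P X ((∑ d, β d • X d) + E) = mosaicResid c P X E := by
  have h (m : Fin M) : clusterResid c P X ((∑ d, β d • X d) + E) m = clusterResid c P X E m := by
    have h1 : blockVec c m ((∑ d, β d • X d) + E)
        = (∑ d, β d • blockVec c m (X d)) + blockVec c m E := by
      ext q
      simp [blockVec, block, Matrix.sum_apply]
    have h2 : ∑ d, β d • blockVec c m (X d) ∈ designSpace c P X m :=
      Submodule.sum_mem _ fun d _ => Submodule.smul_mem _ _
        (Submodule.subset_span (Or.inl ⟨d, rfl⟩))
    rw [clusterResid, clusterResid, h1, map_add, Submodule.starProjection_eq_self_iff.2 h2]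
    abel
  unfold mosaicResid
  simp_rw [h]

/-- A linear form in the rows of cluster `m`. -/
def clusterForm (m : Fin M) (z R : Matrix (Fin N) (Fin T) ℝ) : ℝ :=
  ∑ i with c i = m, ∑ t, z i t * R i t

/-- The linear form in the residuals of a cluster, as a linear form in the errors. -/
theorem exists_clusterForm_mosaicResid_eq_trace (m : Fin M) (z : Matrix (Fin N) (Fin T) ℝ) :
    ∃ A : Matrix (Fin N) (Fin T) ℝ,
      ∑ i, ∑ t, A i t ^ 2 ≤ ∑ i with c i = m, ∑ t, z i t ^ 2 ∧
      (∀ E, clusterForm c m z (mosaicResid c P X E) = (Aᵀ * E).trace) ∧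
      ∀ E, (Aᵀ * E).trace = ∑ i : {i : Fin N // c i = m}, ∑ t, A i t * block c m E i t := by
  -- The residual map is an orthogonal projection: self-adjointness moves it from the errors to the
  -- coefficients, whose norm it does not increase. Extension by zero keeps the form inside cluster
  -- `m`, as independence requires.
  set y := blockVec c m z - (designSpace c P X m).starProjection (blockVec c m z) with hy
  set A : Matrix (Fin N) (Fin T) ℝ :=
    Matrix.of fun i t => if h : c i = m then y (⟨i, h⟩, t) else 0 with hA
  have hsub (f : Fin N → ℝ) :
      ∑ i with c i = m, f i = ∑ i : {i : Fin N // c i = m}, f i :=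
    Finset.sum_subtype _ (fun i => by simp) f
  have hsupp (f : Fin N → ℝ) (hf : ∀ i, c i ≠ m → f i = 0) :
      ∑ i, f i = ∑ i : {i : Fin N // c i = m}, f i := by
    rw [← hsub, Finset.sum_filter_of_ne]
    exact fun i _ hne => by_contra fun hc => hne (hf i hc)
  have hA1 (i : {i : Fin N // c i = m}) (t : Fin T) : A i t = y (i, t) := by
    simp [hA, i.2]
  have hA0 (i : Fin N) (hi : c i ≠ m) (t : Fin T) : A i t = 0 := by simp [hA, hi]
  have htr (E : Matrix (Fin N) (Fin T) ℝ) :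
      (Aᵀ * E).trace = ∑ i : {i : Fin N // c i = m}, ∑ t, A i t * block c m E i t := by
    rw [trace_transpose_mul_eq_sum, hsupp _ fun i hi => by simp [hA0 i hi]]
    rfl
  refine ⟨A, ?_, fun E => ?_, htr⟩
  · rw [hsupp _ fun i hi => by simp [hA0 i hi], hsub]
    have h1 : ‖y‖ ^ 2 ≤ ‖blockVec c m z‖ ^ 2 := by
      gcongr
      rw [hy, ← Submodule.starProjection_orthogonal_val]
      exact Submodule.norm_starProjection_apply_le _ _
    simp only [EuclideanSpace.norm_sq_eq, Real.norm_eq_abs, sq_abs, Fintype.sum_prod_type] at h1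
    simpa [hA1, blockVec, block] using h1
  · rw [htr, clusterForm, hsub]
    have h1 : inner ℝ (blockVec c m z) (clusterResid c P X E m)
        = inner ℝ y (blockVec c m E) := by
      rw [clusterResid, hy, inner_sub_left, inner_sub_right,
        Submodule.inner_starProjection_left_eq_right]
    simp only [PiLp.inner_apply, Fintype.sum_prod_type, RCLike.inner_apply, conj_trivial] at h1
    simp only [hA1]
    have h2 (i : {i : Fin N // c i = m}) (t : Fin T) :
        mosaicResid c P X E i t = clusterResid c P X E m (i, t) := by
      obtain ⟨i, rfl⟩ := i
      rfl
    simp only [h2]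
    refine Eq.trans ?_ (h1.trans ?_)
    · exact Finset.sum_congr rfl fun i _ => Finset.sum_congr rfl fun t _ => mul_comm _ _
    · exact Finset.sum_congr rfl fun i _ => Finset.sum_congr rfl fun t _ => mul_comm _ _

variable {Ω : Type*} [MeasurableSpace Ω] {μ : Measure Ω} [IsProbabilityMeasure μ]
  {ε : Ω → Matrix (Fin N) (Fin T) ℝ} {κ : ℝ}

theorem integral_clusterForm_pow_le (hε : ∀ i t, Measurable fun ω => ε ω i t)
    (hκ : κ ∈ luxemburgSet μ ε) (m : Fin M) (z : Matrix (Fin N) (Fin T) ℝ) (p : ℕ) :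
    ∫ ω, clusterForm c m z (mosaicResid c P X (ε ω)) ^ (2 * p) ∂μ
      ≤ 2 * p.factorial * κ ^ (2 * p) * (∑ i with c i = m, ∑ t, z i t ^ 2) ^ p := by
  obtain ⟨A, hA, hz, -⟩ := exists_clusterForm_mosaicResid_eq_trace c P X m z
  have hκ0 := hκ.1
  simp_rw [hz]
  exact (integrable_and_integral_pow_le hε hκ A p).2.trans (by gcongr)

theorem isIndepFamily_clusterForm {A : Type*} (hε : ∀ i t, Measurable fun ω => ε ω i t)
    (hκ : κ ∈ luxemburgSet μ ε) (h0 : IsMeanZero μ ε) (hind : ClusterIndep μ c ε)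
    (z : Bool × A → Matrix (Fin N) (Fin T) ℝ) :
    IsIndepFamily μ fun m x ω => clusterForm c m (z x) (mosaicResid c P X (ε ω)) := by
  choose A hA hz hb using fun m x => exists_clusterForm_mosaicResid_eq_trace c P X m (z x)
  simp only [hz]
  refine ⟨?_, fun m x => measurable_trace hε _, fun m x => hasAllMoments_trace hε hκ _,
    fun m x => integral_trace_eq_zero h0 _⟩
  simp only [hb]
  exact hind.comp (fun m b x => ∑ i : {i : Fin N // c i = m}, ∑ t, A m x i t * b i t) fun m => by fun_prop

end Residuals

/-! ### Freezing one of two independent clusters. -/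

section Decoupling

variable {Ω : Type*} [MeasurableSpace Ω] {V A : Type*} [Fintype V] [DecidableEq V] [Fintype A]
  {μ : Measure Ω} [IsProbabilityMeasure μ] {Z : V → Bool × A → Ω → ℝ}

theorem IsIndepFamily.integral_mul_of_ne (hZ : IsIndepFamily μ Z) {m m' : V} (hm : m ≠ m')
    {J : Type*} [Fintype J] (x x' : J → Bool × A) :
    ∫ ω, (∏ j, Z m (x j) ω) * ∏ j, Z m' (x' j) ω ∂μ
      = (∫ ω, ∏ j, Z m (x j) ω ∂μ) * ∫ ω, ∏ j, Z m' (x' j) ω ∂μ :=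
  hZ.integral_monomial_mul (fun _ => m) (fun _ => m') x x' fun _ _ => hm

/-- The integral over one cluster is a polynomial in the frozen values `w`, so iterated integrals
reduce to finite sums of products of moments. -/
theorem IsIndepFamily.integral_bilinear_pow_slice (hZ : IsIndepFamily μ Z) (m : V) (n : ℕ)
    (w : A → ℝ) : ∫ ω, (∑ a, Z m (false, a) ω * w a) ^ n ∂μ
      = ∑ α : Fin n → A, (∫ ω, ∏ k, Z m (false, α k) ω ∂μ) * ∏ k, w (α k) := by
  simp_rw [Fintype.sum_pow, Finset.prod_mul_distrib]
  rw [integral_finsetSum]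
  · exact Finset.sum_congr rfl fun α _ => integral_mul_const _ _
  · exact fun α _ => (hZ.hasAllMoments_monomial _ _).integrable.mul_const _

theorem IsIndepFamily.hasAllMoments_bilinear_pow_slice (hZ : IsIndepFamily μ Z) (m m' : V)
    (n : ℕ) : HasAllMoments (fun ω' =>
      ∫ ω, (∑ a, Z m (false, a) ω * Z m' (true, a) ω') ^ n ∂μ) μ := by
  simp_rw [hZ.integral_bilinear_pow_slice m n]
  exact HasAllMoments.sum _ fun α _ => (hZ.hasAllMoments_monomial _ _).const_mul _

/-- The moments of a bilinear form in the vectors of two vertices are iterated integrals. -/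
theorem IsIndepFamily.integral_bilinear_pow (hZ : IsIndepFamily μ Z) {m m' : V} (hm : m ≠ m')
    (n : ℕ) : ∫ ω, (∑ a, Z m (false, a) ω * Z m' (true, a) ω) ^ n ∂μ
      = ∫ ω', ∫ ω, (∑ a, Z m (false, a) ω * Z m' (true, a) ω') ^ n ∂μ ∂μ := by
  simp_rw [hZ.integral_bilinear_pow_slice m n, Fintype.sum_pow, Finset.prod_mul_distrib]
  rw [integral_finsetSum, integral_finsetSum]
  · refine Finset.sum_congr rfl fun α _ => ?_
    rw [hZ.integral_mul_of_ne hm, integral_const_mul]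
  · exact fun α _ => (hZ.hasAllMoments_monomial _ _).integrable.const_mul _
  · exact fun α _ =>
      ((hZ.hasAllMoments_monomial _ _).mul (hZ.hasAllMoments_monomial _ _)).integrable

/-- Jensen's inequality for `y^p` with weights `w`, applied to `W² / w`. This keeps the bound
independent of the number of summands; `h0` covers zero weights, where the quotient is zero by
convention. -/
theorem integral_sum_sq_pow_le (s : Finset A) (W : A → Ω → ℝ) (w : A → ℝ) (p : ℕ) {C : ℝ}
    (hW : ∀ a, HasAllMoments (W a) μ) (hw : ∀ a ∈ s, 0 ≤ w a) (hw1 : ∑ a ∈ s, w a = 1)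
    (h0 : ∀ a ∈ s, w a = 0 → ∀ ω, W a ω = 0) (hC : 0 ≤ C)
    (h : ∀ a ∈ s, ∫ ω, W a ω ^ (2 * p) ∂μ ≤ C * w a ^ p) :
    ∫ ω, (∑ a ∈ s, W a ω ^ 2) ^ p ∂μ ≤ C := by
  have hint (a : A) : Integrable (fun ω => w a * (W a ω ^ 2 / w a) ^ p) μ :=
    ((((hW a).pow 2).div_const _).pow p).integrable.const_mul _
  have hpt (ω : Ω) : (∑ a ∈ s, W a ω ^ 2) ^ p ≤ ∑ a ∈ s, w a * (W a ω ^ 2 / w a) ^ p := by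
    have h1 : ∑ a ∈ s, W a ω ^ 2 = ∑ a ∈ s, w a * (W a ω ^ 2 / w a) := by
      refine Finset.sum_congr rfl fun a ha => ?_
      rcases eq_or_ne (w a) 0 with hwa | hwa
      · simp [hwa, h0 a ha hwa]
      · field_simp
    rw [h1]
    exact Real.pow_arith_mean_le_arith_mean_pow s _ _ hw hw1
      (fun a ha => div_nonneg (sq_nonneg _) (hw a ha)) p
  calc ∫ ω, (∑ a ∈ s, W a ω ^ 2) ^ p ∂μ
      ≤ ∫ ω, ∑ a ∈ s, w a * (W a ω ^ 2 / w a) ^ p ∂μ := by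
        refine integral_mono ?_ (integrable_finsetSum _ fun a _ => hint a) hpt
        exact ((HasAllMoments.sum s fun a _ => (hW a).pow 2).pow p).integrable
    _ = ∑ a ∈ s, w a * ((∫ ω, W a ω ^ (2 * p) ∂μ) / w a ^ p) := by
        rw [integral_finsetSum _ fun a _ => hint a]
        refine Finset.sum_congr rfl fun a _ => ?_
        simp_rw [div_pow, ← pow_mul]
        rw [integral_const_mul, integral_div]
    _ ≤ ∑ a ∈ s, w a * C := by
        refine Finset.sum_le_sum fun a ha => mul_le_mul_of_nonneg_left ?_ (hw a ha)
        exact div_le_of_le_mul₀ (pow_nonneg (hw a ha) p) hC (h a ha)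
    _ = C := by rw [← Finset.sum_mul, hw1, one_mul]

end Decoupling

/-! ### The moment bound for `δ_{m,m'} / √T`. -/

section Coefficients

variable {N T M D : ℕ} (c : Fin N → Fin M) (P : Matrix (Fin T) (Fin T) ℝ)
  (s : Matrix (Fin N) (Fin N) ℝ)

/-- The coefficients of the linear forms whose products make up `δ_{m,m'} / √T`. -/
def edgeCoeff (x : Bool × (Fin N × Fin T)) : Matrix (Fin N) (Fin T) ℝ :=
  Matrix.of fun j u => if x.1 then (√T)⁻¹ * (s x.2.1 j * (1 - P) x.2.2 u)
    else if j = x.2.1 ∧ u = x.2.2 then 1 else 0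

theorem clusterForm_edgeCoeff_false (m : Fin M) (a : Fin N × Fin T)
    (R : Matrix (Fin N) (Fin T) ℝ) :
    clusterForm c m (edgeCoeff P s (false, a)) R = if c a.1 = m then R a.1 a.2 else 0 := by
  obtain ⟨i, t⟩ := a
  simp [clusterForm, edgeCoeff, ite_and]

theorem clusterForm_edgeCoeff_true (m : Fin M) (i : Fin N) (t : Fin T)
    (R : Matrix (Fin N) (Fin T) ℝ) :
    clusterForm c m (edgeCoeff P s (true, (i, t))) R
      = (√T)⁻¹ * ∑ j with c j = m, s i j * ((1 - P) *ᵥ R j) t := by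
  simp only [clusterForm, edgeCoeff, Matrix.of_apply, if_true, Matrix.mulVec, dotProduct,
    Finset.mul_sum]
  exact Finset.sum_congr rfl fun j _ => Finset.sum_congr rfl fun u _ => by ring

theorem sum_edgeCoeff_false_mul (m : Fin M) (R : Matrix (Fin N) (Fin T) ℝ)
    (w : Fin N × Fin T → ℝ) :
    ∑ a, clusterForm c m (edgeCoeff P s (false, a)) R * w a
      = clusterForm c m (Matrix.of fun i t => w (i, t)) R := by
  simp only [clusterForm_edgeCoeff_false, Fintype.sum_prod_type, ite_mul, zero_mul]
  rw [clusterForm, Finset.sum_filter]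
  refine Finset.sum_congr rfl fun i _ => ?_
  split_ifs
  · exact Finset.sum_congr rfl fun t _ => mul_comm _ _
  · simp

theorem sum_edgeCoeff_mul_eq_clusterDelta (m m' : Fin M) (R : Matrix (Fin N) (Fin T) ℝ) :
    ∑ a, clusterForm c m (edgeCoeff P s (false, a)) R
        * clusterForm c m' (edgeCoeff P s (true, a)) R
      = (√T)⁻¹ * clusterDelta c P s R m m' := by
  rw [sum_edgeCoeff_false_mul c P s m R
    fun a => clusterForm c m' (edgeCoeff P s (true, a)) R]
  simp only [clusterForm_edgeCoeff_true, clusterDelta]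
  rw [clusterForm, Finset.mul_sum]
  refine Finset.sum_congr rfl fun i _ => ?_
  simp only [Matrix.of_apply, Finset.mul_sum, Finset.sum_mul, dotProduct]
  rw [Finset.sum_comm]
  exact Finset.sum_congr rfl fun j _ => Finset.sum_congr rfl fun t _ => by ring

/-- A symmetric involution is orthogonal, so its rows are unit vectors. -/
theorem sum_sq_one_sub_row_le (hP : P.IsSymm) (hP2 : P ^ 2 = 1) (t : Fin T) :
    ∑ u, (1 - P) t u ^ 2 ≤ 4 := by
  have h1 : ∑ u, P t u ^ 2 = 1 := by
    have := congrFun (congrFun hP2 t) t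
    rw [sq, Matrix.mul_apply, Matrix.one_apply_eq] at this
    rw [← this]
    exact Finset.sum_congr rfl fun u _ => by rw [sq, hP.apply t u]
  have h2 : ∑ u, (1 : Matrix (Fin T) (Fin T) ℝ) t u ^ 2 = 1 := by
    simp [Matrix.one_apply]
  calc ∑ u, (1 - P) t u ^ 2
      ≤ ∑ u, (2 * (1 : Matrix (Fin T) (Fin T) ℝ) t u ^ 2 + 2 * P t u ^ 2) :=
        Finset.sum_le_sum fun u _ => by
          rw [Matrix.sub_apply]
          nlinarith [sq_nonneg ((1 : Matrix (Fin T) (Fin T) ℝ) t u + P t u)]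
    _ = 4 := by rw [Finset.sum_add_distrib, ← Finset.mul_sum, ← Finset.mul_sum, h1, h2]; norm_num

theorem sum_edgeCoeff_true_sq_le (hP : P.IsSymm) (hP2 : P ^ 2 = 1) (m : Fin M) (i : Fin N)
    (t : Fin T) : ∑ j with c j = m, ∑ u, edgeCoeff P s (true, (i, t)) j u ^ 2
      ≤ 4 * ((∑ j with c j = m, s i j ^ 2) / T) := by
  have h : ∑ j with c j = m, ∑ u, edgeCoeff P s (true, (i, t)) j u ^ 2
      = (∑ u, (1 - P) t u ^ 2) * ((∑ j with c j = m, s i j ^ 2) / T) := by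
    rw [Finset.sum_div, Finset.mul_sum]
    refine Finset.sum_congr rfl fun j _ => ?_
    rw [Finset.sum_mul]
    refine Finset.sum_congr rfl fun u _ => ?_
    simp only [edgeCoeff, Matrix.of_apply, if_true, mul_pow, inv_pow,
      Real.sq_sqrt (Nat.cast_nonneg T)]
    ring
  rw [h]
  gcongr
  exact sum_sq_one_sub_row_le P hP hP2 t

variable {Ω : Type*} [MeasurableSpace Ω] {μ : Measure Ω} [IsProbabilityMeasure μ]
  {ε : Ω → Matrix (Fin N) (Fin T) ℝ} {κ : ℝ} (X : Fin D → Matrix (Fin N) (Fin T) ℝ)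

/-- The bound on the moment of order `2 p` of `δ_{m,m'} / √T`. -/
def momentBound (p : ℕ) (κ : ℝ) : ℝ := (2 * p.factorial * κ ^ (2 * p)) ^ 2 * 4 ^ p

theorem momentBound_nonneg (p : ℕ) (κ : ℝ) : 0 ≤ momentBound p κ := by
  unfold momentBound; positivity

theorem integral_bilinear_pow_le (hT : 0 < T) (hP : P.IsSymm) (hP2 : P ^ 2 = 1)
    (hs : IsWeight c s) (hε : ∀ i t, Measurable fun ω => ε ω i t)
    (hκ : κ ∈ luxemburgSet μ ε) (h0 : IsMeanZero μ ε) (hind : ClusterIndep μ c ε)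
    {m m' : Fin M} (hm : m ≠ m') (p : ℕ) :
    ∫ ω, (∑ a, clusterForm c m (edgeCoeff P s (false, a)) (mosaicResid c P X (ε ω))
        * clusterForm c m' (edgeCoeff P s (true, a)) (mosaicResid c P X (ε ω))) ^ (2 * p) ∂μ
      ≤ momentBound p κ := by
  have hZ := isIndepFamily_clusterForm c P X hε hκ h0 hind (edgeCoeff P s)
  have hT' : (0 : ℝ) < T := by exact_mod_cast hT
  have hκ0 := hκ.1
  set B := 2 * p.factorial * κ ^ (2 * p) with hB
  have hB0 : 0 ≤ B := by positivity
  rw [hZ.integral_bilinear_pow hm (2 * p)]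
  set W := fun (a : Fin N × Fin T) ω =>
    clusterForm c m' (edgeCoeff P s (true, a)) (mosaicResid c P X (ε ω))
  have hW (a : Fin N × Fin T) : HasAllMoments (W a) μ := hZ.moments m' (true, a)
  set S : Finset (Fin N × Fin T) := (Finset.univ.filter fun i => c i = m) ×ˢ Finset.univ
  -- These are the Jensen weights: summed over the rows of `C_m` and the `T` times they give one, by
  -- the normalization of `s`.
  set w := fun a : Fin N × Fin T => (∑ j with c j = m', s a.1 j ^ 2) / T
  -- For frozen `ω'` this is a linear form in the residuals of cluster `m` with coefficients `W a
  -- ω'`.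
  have hslice (ω' : Ω) : ∫ ω, (∑ a, clusterForm c m (edgeCoeff P s (false, a))
      (mosaicResid c P X (ε ω)) * W a ω') ^ (2 * p) ∂μ ≤ B * (∑ a ∈ S, W a ω' ^ 2) ^ p := by
    simp_rw [sum_edgeCoeff_false_mul]
    refine (integral_clusterForm_pow_le c P X hε hκ m _ p).trans_eq ?_
    rw [Finset.sum_product]
    rfl
  have hJ : ∫ ω, (∑ a ∈ S, W a ω ^ 2) ^ p ∂μ ≤ B * 4 ^ p := by
    refine integral_sum_sq_pow_le S W w p hW (fun a _ => by positivity) ?_ ?_ (by positivity) ?_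
    · rw [Finset.sum_product]
      simp only [w, Finset.sum_const, Finset.card_univ, Fintype.card_fin, nsmul_eq_mul]
      simp_rw [mul_div_cancel₀ _ hT'.ne']
      exact hs.normalized m m' hm
    · rintro ⟨i, t⟩ - ha ω
      have h1 : ∑ j with c j = m', s i j ^ 2 = 0 := by
        rcases div_eq_zero_iff.1 ha with h | h
        · exact h
        · exact absurd h hT'.ne'
      simp only [W, clusterForm_edgeCoeff_true]
      rw [Finset.sum_eq_zero, mul_zero]
      intro j hj
      rw [pow_eq_zero_iff two_ne_zero |>.1
        ((Finset.sum_eq_zero_iff_of_nonneg fun j _ => sq_nonneg _).1 h1 j hj), zero_mul]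
    · rintro ⟨i, t⟩ -
      refine (integral_clusterForm_pow_le c P X hε hκ m' _ p).trans ?_
      rw [mul_assoc B (4 ^ p), ← mul_pow]
      gcongr
      exact sum_edgeCoeff_true_sq_le c P s hP hP2 m' i t
  calc _ ≤ ∫ ω', B * (∑ a ∈ S, W a ω' ^ 2) ^ p ∂μ := by
        refine integral_mono (hZ.hasAllMoments_bilinear_pow_slice m m' (2 * p)).integrable ?_ hslice
        exact ((HasAllMoments.sum S fun a _ => (hW a).pow 2).pow p).integrable.const_mul _
    _ = B * ∫ ω', (∑ a ∈ S, W a ω' ^ 2) ^ p ∂μ := integral_const_mul _ _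
    _ ≤ B * (B * 4 ^ p) := by gcongr
    _ = momentBound p κ := by rw [momentBound, ← hB]; ring

end Coefficients

/-! ### The centered statistics as signed sums over pairs of clusters. -/

section Statistic

variable {N T M : ℕ} (c : Fin N → Fin M) (P : Matrix (Fin T) (Fin T) ℝ)
  (s : Matrix (Fin N) (Fin N) ℝ)

/-- The indicator of the increasing pairs. -/
def pairWeight (p : Fin M × Fin M) : ℝ := if p.1 < p.2 then 1 else 0

theorem sum_ne_eq_two_mul_sum_pairWeight (h : Fin M → Fin M → ℝ) (hh : ∀ m m', h m m' = h m' m) :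
    ∑ m, ∑ m' with m' ≠ m, h m m' = 2 * ∑ p : Fin M × Fin M, pairWeight p * h p.1 p.2 := by
  have h1 (m m' : Fin M) : (if m' ≠ m then h m m' else 0)
      = pairWeight (m, m') * h m m' + pairWeight (m', m) * h m' m := by
    rcases lt_trichotomy m m' with hlt | rfl | hlt
    · simp [pairWeight, hlt, hlt.ne', hlt.not_gt]
    · simp [pairWeight]
    · simp [pairWeight, hlt, hlt.ne, hlt.not_gt, hh m m']
  simp only [Finset.sum_filter, h1, Finset.sum_add_distrib, Fintype.sum_prod_type]
  rw [Finset.sum_comm (f := fun m m' => pairWeight (m', m) * h m' m)]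
  ring

theorem sum_cluster_ne_eq (F : Fin N → Fin N → ℝ) :
    ∑ m, ∑ i with c i = m, ∑ j with c j ≠ m, F i j
      = ∑ m, ∑ m' with m' ≠ m, ∑ i with c i = m, ∑ j with c j = m', F i j := by
  refine Finset.sum_congr rfl fun m _ => ?_
  rw [Finset.sum_comm (s := Finset.univ.filter fun m' => m' ≠ m)]
  refine Finset.sum_congr rfl fun i _ => ?_
  rw [← Finset.sum_fiberwise_of_maps_to (t := Finset.univ.filter fun m' => m' ≠ m) (g := c)
    (fun j hj => by simpa using hj)]
  refine Finset.sum_congr rfl fun m' hm' => Finset.sum_congr ?_ fun _ _ => rfl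
  have hm := (Finset.mem_filter.1 hm').2
  ext j
  simp only [Finset.mem_filter, Finset.mem_univ, true_and]
  exact ⟨fun h => h.2, fun h => ⟨h ▸ hm, h⟩⟩

/-- Equal coins give `x ⬝ᵥ y` because `P` cancels, unequal ones give `x ⬝ᵥ (P *ᵥ y)`: the half-sum
is free of the coins and the half-difference carries the signs. -/
theorem dotProduct_vecMul_pow_toNat (hP : P.IsSymm) (hP2 : P ^ 2 = 1) (x y : Fin T → ℝ)
    (b b' : Bool) : (x ᵥ* P ^ b.toNat) ⬝ᵥ (y ᵥ* P ^ b'.toNat)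
      = (x ⬝ᵥ y + x ⬝ᵥ (P *ᵥ y)) / 2
        + coinSign b * coinSign b' * (x ⬝ᵥ ((1 - P) *ᵥ y)) / 2 := by
  have h1 (z : Fin T → ℝ) : z ᵥ* P = P *ᵥ z := by
    rw [← Matrix.mulVec_transpose, hP.eq]
  have h2 : (x ᵥ* P) ⬝ᵥ (P *ᵥ y) = x ⬝ᵥ y := by
    rw [← Matrix.dotProduct_mulVec, Matrix.mulVec_mulVec, ← sq, hP2, Matrix.one_mulVec]
  have h3 : (x ᵥ* P) ⬝ᵥ y = x ⬝ᵥ (P *ᵥ y) := (Matrix.dotProduct_mulVec _ _ _).symm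
  rw [Matrix.sub_mulVec, Matrix.one_mulVec, dotProduct_sub]
  cases b <;> cases b' <;> simp only [Bool.toNat_false, Bool.toNat_true, pow_zero, pow_one,
    Matrix.vecMul_one, coinSign, if_true, h2, h3, h1 y, Bool.false_eq_true, if_false] <;> ring

theorem clusterDelta_comm (hP : P.IsSymm) (hs : ∀ i j, s i j = s j i)
    (R : Matrix (Fin N) (Fin T) ℝ) (m m' : Fin M) :
    clusterDelta c P s R m m' = clusterDelta c P s R m' m := by
  unfold clusterDelta
  rw [Finset.sum_comm]
  refine Finset.sum_congr rfl fun j _ => Finset.sum_congr rfl fun i _ => ?_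
  rw [hs i j, Matrix.dotProduct_mulVec, dotProduct_comm, ← Matrix.mulVec_transpose,
    Matrix.transpose_sub, hP.eq, Matrix.transpose_one]

/-- The half in front of the signed part cancels against the two orders in which each pair of
clusters is counted. -/
theorem quadStat_mosaicRandomize (hP : P.IsSymm) (hP2 : P ^ 2 = 1) (hs : ∀ i j, s i j = s j i)
    (b : Fin M → Bool) (R : Matrix (Fin N) (Fin T) ℝ) :
    quadStat c s (mosaicRandomize c P b R)
      = (∑ m, ∑ i with c i = m, ∑ j with c j ≠ m,
          s i j * ((R i ⬝ᵥ R j + R i ⬝ᵥ (P *ᵥ R j)) / 2))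
        + ∑ p : Fin M × Fin M, pairWeight p
          * (coinSign (b p.1) * coinSign (b p.2) * clusterDelta c P s R p.1 p.2) := by
  have hrow (i : Fin N) : mosaicRandomize c P b R i = R i ᵥ* P ^ (b (c i)).toNat := by
    ext t
    rw [mosaicRandomize, Matrix.of_apply, Matrix.mul_apply_eq_vecMul]
  have h2 := sum_ne_eq_two_mul_sum_pairWeight
    (fun m m' => coinSign (b m) * coinSign (b m') * clusterDelta c P s R m m')
    (fun m m' => by rw [clusterDelta_comm c P s hP hs R m m', mul_comm (coinSign (b m))])
  have h3 : ∑ m, ∑ m' with m' ≠ m, coinSign (b m) * coinSign (b m') * clusterDelta c P s R m m'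
      = 2 * ∑ m, ∑ i with c i = m, ∑ j with c j ≠ m, s i j *
        (coinSign (b (c i)) * coinSign (b (c j)) * (R i ⬝ᵥ ((1 - P) *ᵥ R j)) / 2) := by
    rw [sum_cluster_ne_eq, Finset.mul_sum]
    refine Finset.sum_congr rfl fun m _ => ?_
    rw [Finset.mul_sum]
    refine Finset.sum_congr rfl fun m' _ => ?_
    simp only [clusterDelta, Finset.mul_sum]
    refine Finset.sum_congr rfl fun i hi => Finset.sum_congr rfl fun j hj => ?_
    rw [(Finset.mem_filter.1 hi).2, (Finset.mem_filter.1 hj).2]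
    ring
  rw [h3, mul_right_inj' two_ne_zero] at h2
  rw [← h2]
  simp only [quadStat, ← Finset.sum_add_distrib, hrow,
    dotProduct_vecMul_pow_toNat P hP hP2, mul_add]

theorem randExp_coinSign_mul {m m' : Fin M} (hm : m ≠ m') :
    randExp (fun b => coinSign (b m) * coinSign (b m')) = 0 := by
  have h := signMean_eq ![m, m']
  rw [Finset.prod_eq_zero (Finset.mem_univ m)] at h
  · simpa [signMean, Fin.prod_univ_two, randExp] using h
  · have : mult ![m, m'] m = 1 := by
      simp [mult_eq_sum, -Finset.sum_boole, Fin.sum_univ_two, hm.symm]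
    simp [this]

theorem randExp_const_add_sum (x : ℝ) (f : Fin M × Fin M → ℝ) :
    randExp (fun b => x + ∑ p : Fin M × Fin M, pairWeight p
      * (coinSign (b p.1) * coinSign (b p.2) * f p)) = x := by
  have h (p : Fin M × Fin M) : ∑ b : Fin M → Bool,
      pairWeight p * (coinSign (b p.1) * coinSign (b p.2) * f p) = 0 := by
    rw [← Finset.mul_sum, ← Finset.sum_mul]
    by_cases hp : p.1 < p.2
    · have := randExp_coinSign_mul hp.ne
      rw [randExp, div_eq_zero_iff] at this
      rw [this.resolve_right (by positivity), zero_mul, mul_zero]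
    · simp [pairWeight, hp]
  rw [randExp, Finset.sum_add_distrib, Finset.sum_comm, Finset.sum_eq_zero fun p _ => h p]
  simp

theorem centeredRandStat_eq (hP : P.IsSymm) (hP2 : P ^ 2 = 1) (hs : ∀ i j, s i j = s j i)
    (b : Fin M → Bool) (R : Matrix (Fin N) (Fin T) ℝ) :
    centeredRandStat c P s b R = ∑ p : Fin M × Fin M, pairWeight p
      * (coinSign (b p.1) * coinSign (b p.2) * clusterDelta c P s R p.1 p.2) := by
  unfold centeredRandStat
  simp only [quadStat_mosaicRandomize c P s hP hP2 hs]
  rw [randExp_const_add_sum _ fun p => clusterDelta c P s R p.1 p.2]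
  ring

theorem centeredStat_eq (hP : P.IsSymm) (hP2 : P ^ 2 = 1) (hs : ∀ i j, s i j = s j i)
    (R : Matrix (Fin N) (Fin T) ℝ) :
    centeredStat c P s R
      = ∑ p : Fin M × Fin M, pairWeight p * clusterDelta c P s R p.1 p.2 := by
  -- The observed statistic is the randomized one with no cluster flipped.
  have h : mosaicRandomize c P (fun _ => false) R = R := by
    ext i t; simp [mosaicRandomize]
  have h1 := centeredRandStat_eq c P s hP hP2 hs (fun _ => false) R
  rw [centeredRandStat, h] at h1
  rw [centeredStat, h1]
  simp [coinSign]

end Statistic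

/-! ### Distinct edges are uncorrelated. -/

section Variance

variable {Ω : Type*} [MeasurableSpace Ω] {M : ℕ} {A : Type*} [Fintype A]
  {μ : Measure Ω} [IsProbabilityMeasure μ] {Z : Fin M → Bool × A → Ω → ℝ}

theorem IsIndepFamily.integral_edgeForm (hZ : IsIndepFamily μ Z) (p : Fin M × Fin M) :
    ∫ ω, edgeForm pairWeight Z p ω ∂μ = 0 := by
  by_cases hp : p.1 < p.2
  · have hm : mult (vert ![p]) p.1 = 1 := by
      simp [mult_eq_sum, -Finset.sum_boole, Fintype.sum_prod_type, vert, hp.ne']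
    simpa using hZ.integral_prod_edgeForm_eq_zero (θ := pairWeight) ![p] p.1 hm
  · simp [edgeForm, pairWeight, hp]

theorem IsIndepFamily.integral_edgeForm_mul_of_ne (hZ : IsIndepFamily μ Z) {p q : Fin M × Fin M}
    (hpq : p ≠ q) : ∫ ω, edgeForm pairWeight Z p ω * edgeForm pairWeight Z q ω ∂μ = 0 := by
  by_cases hp : p.1 < p.2
  swap
  · simp [edgeForm, pairWeight, hp]
  by_cases hq : q.1 < q.2
  swap
  · simp [edgeForm, pairWeight, hq]
  have hmult (m : Fin M) : mult (vert ![p, q]) m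
      = (if p.1 = m then 1 else 0) + (if p.2 = m then 1 else 0)
        + ((if q.1 = m then 1 else 0) + (if q.2 = m then 1 else 0)) := by
    simp [mult_eq_sum, -Finset.sum_boole, Fintype.sum_prod_type, vert, add_comm]
    rfl
  -- Two distinct increasing pairs share at most one vertex, so an endpoint of `p` is missing from
  -- `q`.
  obtain ⟨m, hm⟩ : ∃ m, mult (vert ![p, q]) m = 1 := by
    by_cases h1 : q.1 = p.1 ∨ q.2 = p.1
    · refine ⟨p.2, ?_⟩
      have h2 : q.1 ≠ p.2 ∧ q.2 ≠ p.2 := by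
        rw [Ne, Prod.ext_iff] at hpq
        omega
      simp [hmult, hp.ne, h2]
    · push Not at h1
      exact ⟨p.1, by simp [hmult, hp.ne', h1]⟩
  simpa [Fin.prod_univ_two] using
    hZ.integral_prod_edgeForm_eq_zero (θ := pairWeight) ![p, q] m hm

theorem IsIndepFamily.variance_sum_edgeForm (hZ : IsIndepFamily μ Z) :
    variance (fun ω => ∑ p, edgeForm pairWeight Z p ω) μ
      = ∑ p, variance (edgeForm pairWeight Z p) μ := by
  have hd (p : Fin M × Fin M) : HasAllMoments (edgeForm pairWeight Z p) μ :=
    hZ.hasAllMoments_edgeForm p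
  have hs : HasAllMoments (fun ω => ∑ p, edgeForm pairWeight Z p ω) μ :=
    HasAllMoments.sum _ fun p _ => hd p
  have hs0 : ∫ ω, ∑ p, edgeForm pairWeight Z p ω ∂μ = 0 := by
    rw [integral_finsetSum _ fun p _ => (hd p).integrable]
    exact Finset.sum_eq_zero fun p _ => hZ.integral_edgeForm p
  rw [variance_of_integral_eq_zero hs.integrable.aemeasurable hs0]
  simp_rw [fun p => variance_of_integral_eq_zero (hd p).integrable.aemeasurable
    (hZ.integral_edgeForm p), sq, Finset.sum_mul_sum]
  rw [integral_finsetSum _ fun p _ =>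
    (HasAllMoments.sum _ fun q _ => (hd p).mul (hd q)).integrable]
  refine Finset.sum_congr rfl fun p _ => ?_
  rw [integral_finsetSum _ fun q _ => ((hd p).mul (hd q)).integrable]
  exact Finset.sum_eq_single p (fun q _ hq => hZ.integral_edgeForm_mul_of_ne hq.symm)
    fun h => absurd (Finset.mem_univ p) h

end Variance

/-! ### Normalization and comparison of moments. -/

section Assembly

variable {N T M D : ℕ} {Ω : Type*} [MeasurableSpace Ω] {μ : Measure Ω} {c : Fin N → Fin M}
  {P : Matrix (Fin T) (Fin T) ℝ} {s : Matrix (Fin N) (Fin N) ℝ}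

/-- The linear forms in the residuals whose products make up `δ_{m,m'} / √T`. -/
def residForm (c : Fin N → Fin M) (P : Matrix (Fin T) (Fin T) ℝ) (s : Matrix (Fin N) (Fin N) ℝ)
    (R : Ω → Matrix (Fin N) (Fin T) ℝ) (m : Fin M) (x : Bool × (Fin N × Fin T)) (ω : Ω) : ℝ :=
  clusterForm c m (edgeCoeff P s x) (R ω)

theorem edgeForm_residForm (R : Ω → Matrix (Fin N) (Fin T) ℝ) (p : Fin M × Fin M) (ω : Ω) :
    edgeForm pairWeight (residForm c P s R) p ω
      = pairWeight p * ((√T)⁻¹ * clusterDelta c P s (R ω) p.1 p.2) := by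
  rw [edgeForm, ← sum_edgeCoeff_mul_eq_clusterDelta]
  rfl

/-- In the degenerate cases `1 / √T` or `1 / M.choose 2` is `1 / 0 = 0`, which makes `σ_δ²` vanish.
-/
theorem pos_of_sigmaDeltaSq_pos {R : Ω → Matrix (Fin N) (Fin T) ℝ}
    (h : 0 < sigmaDeltaSq μ c P s R) : 0 < T ∧ 2 ≤ M := by
  constructor
  · by_contra hT
    obtain rfl : T = 0 := by omega
    have hv : variance (fun _ : Ω => (0 : ℝ)) μ = 0 := variance_zero μ
    simp [sigmaDeltaSq, hv] at h
  · by_contra hM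
    have : M.choose 2 = 0 := Nat.choose_eq_zero_of_lt (by omega)
    simp [sigmaDeltaSq, this] at h

theorem sigmaDeltaSq_eq (R : Ω → Matrix (Fin N) (Fin T) ℝ) :
    sigmaDeltaSq μ c P s R = (1 / (M.choose 2 : ℝ))
      * ∑ p, variance (edgeForm pairWeight (residForm c P s R) p) μ := by
  rw [sigmaDeltaSq, Fintype.sum_prod_type]
  congr 1
  refine Finset.sum_congr rfl fun m _ => ?_
  rw [Finset.sum_filter]
  refine Finset.sum_congr rfl fun m' _ => ?_
  have h := funext (edgeForm_residForm (c := c) (P := P) (s := s) R (m, m'))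
  rw [h]
  split_ifs with hm
  · simp [pairWeight, hm]
  · simp only [pairWeight, hm, if_false, zero_mul]
    exact (variance_zero μ).symm

theorem sqrt_mul_edgeForm (hT : 0 < T) (R : Ω → Matrix (Fin N) (Fin T) ℝ) (p : Fin M × Fin M)
    (ω : Ω) : √T * edgeForm pairWeight (residForm c P s R) p ω
      = pairWeight p * clusterDelta c P s (R ω) p.1 p.2 := by
  have hT' : √(T : ℝ) ≠ 0 := (Real.sqrt_pos.2 (by exact_mod_cast hT)).ne'
  rw [edgeForm_residForm]
  field_simp

theorem centeredRandStat_eq_sum_edgeForm (hT : 0 < T) (hP : P.IsSymm) (hP2 : P ^ 2 = 1)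
    (hs : IsWeight c s) (R : Ω → Matrix (Fin N) (Fin T) ℝ) (b : Fin M → Bool) (ω : Ω) :
    centeredRandStat c P s b (R ω) = √T * ∑ p : Fin M × Fin M, coinSign (b p.1) * coinSign (b p.2)
      * edgeForm pairWeight (residForm c P s R) p ω := by
  rw [centeredRandStat_eq c P s hP hP2 hs.symm, Finset.mul_sum]
  refine Finset.sum_congr rfl fun p _ => ?_
  rw [mul_left_comm, ← sqrt_mul_edgeForm hT]
  ring

theorem centeredStat_eq_sum_edgeForm (hT : 0 < T) (hP : P.IsSymm) (hP2 : P ^ 2 = 1)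
    (hs : IsWeight c s) (R : Ω → Matrix (Fin N) (Fin T) ℝ) (ω : Ω) :
    centeredStat c P s (R ω) = √T * ∑ p, edgeForm pairWeight (residForm c P s R) p ω := by
  rw [centeredStat_eq c P s hP hP2 hs.symm, Finset.mul_sum]
  exact Finset.sum_congr rfl fun p _ => (sqrt_mul_edgeForm hT R p ω).symm

theorem sigma_sq_eq [IsProbabilityMeasure μ] (hT : 0 < T) (hM : 2 ≤ M) (hP : P.IsSymm)
    (hP2 : P ^ 2 = 1) (hs : IsWeight c s) {R : Ω → Matrix (Fin N) (Fin T) ℝ}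
    (hZ : IsIndepFamily μ (residForm c P s R)) :
    sigma μ c P s R ^ 2 = T * (M.choose 2 * sigmaDeltaSq μ c P s R) := by
  have hc : (M.choose 2 : ℝ) ≠ 0 := by exact_mod_cast (Nat.choose_pos hM).ne'
  rw [sigma, Real.sq_sqrt (variance_nonneg _ _)]
  simp_rw [centeredStat_eq_sum_edgeForm hT hP hP2 hs]
  rw [variance_const_mul, hZ.variance_sum_edgeForm, Real.sq_sqrt (Nat.cast_nonneg T),
    sigmaDeltaSq_eq, ← mul_assoc (M.choose 2 : ℝ), mul_one_div_cancel hc, one_mul]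

/-- The constant of the theorem, for errors whose sub-Gaussian norm is less than `κ`. -/
def momentConst (K : ℕ) (κ : ℝ) : ℝ :=
  4 ^ K * (2 * (1 + K * momentBound K κ) * (2 * K : ℕ) ^ (4 * K))

theorem sq_le_four_mul_choose (hM : 2 ≤ M) : (M : ℝ) ^ 2 ≤ 4 * M.choose 2 := by
  rw [Nat.cast_choose_two]
  have : (2 : ℝ) ≤ M := by exact_mod_cast hM
  nlinarith

theorem moment_comparison [IsProbabilityMeasure μ] (hT : 0 < T) (hM : 2 ≤ M) (hP : P.IsSymm)
    (hP2 : P ^ 2 = 1) (hs : IsWeight c s) {R : Ω → Matrix (Fin N) (Fin T) ℝ}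
    (hZ : IsIndepFamily μ (residForm c P s R)) (hpos : 0 < sigmaDeltaSq μ c P s R) (K : ℕ) {B : ℝ}
    (hB0 : 0 ≤ B)
    (hB : ∀ p, ∫ ω, edgeForm pairWeight (residForm c P s R) p ω ^ (2 * K) ∂μ ≤ B) :
    Integrable (fun ω => Delta μ c P s R ω ^ K) μ ∧
    Integrable (fun ω => (moment μ c P s R K - momentRand μ c P s R K ω) ^ 2) μ ∧
    ∫ ω, (moment μ c P s R K - momentRand μ c P s R K ω) ^ 2 ∂μ ≤
      4 ^ K * (2 * (1 + K * B) * (2 * K : ℕ) ^ (4 * K)) / sigmaDeltaSq μ c P s R ^ K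
        * (1 / (M : ℝ)) := by
  have hT' : (0 : ℝ) < T := by exact_mod_cast hT
  have hM' : (0 : ℝ) < M := by exact_mod_cast (by omega : 0 < M)
  have hc : (0 : ℝ) < M.choose 2 := by exact_mod_cast Nat.choose_pos hM
  set r := √T / sigma μ c P s R with hr
  have hr2 : r ^ 2 = 1 / (M.choose 2 * sigmaDeltaSq μ c P s R) := by
    rw [hr, div_pow, sigma_sq_eq hT hM hP hP2 hs hZ, Real.sq_sqrt hT'.le]
    field_simp
  have hDelta (ω : Ω) : Delta μ c P s R ω ^ K
      = r ^ K * (∑ p, edgeForm pairWeight (residForm c P s R) p ω) ^ K := by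
    rw [Delta, centeredStat_eq_sum_edgeForm hT hP hP2 hs, ← mul_pow, hr]
    congr 1; ring
  have hRand (ω : Ω) (b : Fin M → Bool) : DeltaRand μ c P s R ω b ^ K
      = r ^ K * (∑ p : Fin M × Fin M, coinSign (b p.1) * coinSign (b p.2)
        * edgeForm pairWeight (residForm c P s R) p ω) ^ K := by
    rw [DeltaRand, centeredRandStat_eq_sum_edgeForm hT hP hP2 hs, ← mul_pow, hr]
    congr 1; ring
  have hdiff (ω : Ω) : (moment μ c P s R K - momentRand μ c P s R K ω) ^ 2
      = (r ^ 2) ^ K * (∑ e : Fin K → Fin M × Fin M,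
        edgeDefect μ pairWeight (residForm c P s R) e ω) ^ 2 := by
    rw [← hZ.integral_sub_average_eq_sum_edgeDefect, moment, momentRand, randExp]
    simp_rw [hDelta, hRand]
    rw [integral_const_mul, ← Finset.mul_sum, mul_div_assoc, ← mul_sub, mul_pow, Fintype.card_fin,
      pow_right_comm]
  have hmom : HasAllMoments (fun ω => ∑ e : Fin K → Fin M × Fin M,
      edgeDefect μ pairWeight (residForm c P s R) e ω) μ :=
    HasAllMoments.sum _ fun e _ => hZ.hasAllMoments_edgeDefect e
  simp_rw [hDelta, hdiff]
  refine ⟨?_, ((hmom.pow 2).const_mul _).integrable, ?_⟩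
  · exact (((HasAllMoments.sum _ fun p _ => hZ.hasAllMoments_edgeForm p).pow K).const_mul
      _).integrable
  have hI := hZ.integral_sum_edgeDefect_sq_le K hB hB0
  rw [integral_const_mul, hr2]
  set I := ∫ ω, (∑ e : Fin K → Fin M × Fin M,
    edgeDefect μ pairWeight (residForm c P s R) e ω) ^ 2 ∂μ
  set S := sigmaDeltaSq μ c P s R
  set C := 2 * (1 + K * B) * ((2 * K : ℕ) : ℝ) ^ (4 * K) with hC
  have hC0 : 0 ≤ C := by positivity
  rw [Fintype.card_fin, ← mul_assoc, ← hC, pow_mul (M : ℝ)] at hI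
  rw [mul_one_div, le_div_iff₀ hM', div_pow, one_pow, one_div_mul_eq_div, div_mul_eq_mul_div,
    mul_pow, div_le_div_iff₀ (by positivity) (by positivity)]
  -- The count carries `M^(2K)` and the normalization `M.choose 2 ^ K`; their ratio costs the factor
  -- `4 ^ K` of the constant.
  calc I * M * S ^ K ≤ C * ((M : ℝ) ^ 2) ^ K * S ^ K := by gcongr
    _ ≤ C * (4 * M.choose 2) ^ K * S ^ K := by
        gcongr
        exact sq_le_four_mul_choose hM
    _ = 4 ^ K * C * (M.choose 2 ^ K * S ^ K) := by rw [mul_pow]; ring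

end Assembly

end Panel

end
theorem mainTheorem3 (K : ℕ) :
    -- `a C` is the constant `a_K` for errors of sub-Gaussian norm `C`
    ∃ a : ℝ → ℝ,
      ∀ (N T M D : ℕ) (Ω : Type*) [MeasurableSpace Ω] (μ : Measure Ω) [IsProbabilityMeasure μ]
        (c : Fin N → Fin M) (P : Matrix (Fin T) (Fin T) ℝ) (s : Matrix (Fin N) (Fin N) ℝ)
        (X : Fin D → Matrix (Fin N) (Fin T) ℝ) (β : Fin D → ℝ)
        (ε Y epsHat : Ω → Matrix (Fin N) (Fin T) ℝ),
        P.IsSymm → P ^ 2 = 1 →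
        Panel.IsWeight c s →
        (∀ i t, Measurable fun ω => ε ω i t) →
        Panel.IsMeanZero μ ε →
        Panel.IsSubGaussian μ ε →
        Panel.ClusterIndep μ c ε →
        (∀ ω, Y ω = (∑ d, β d • X d) + ε ω) →
        (∀ ω, epsHat ω = Panel.mosaicResid c P X (Y ω)) →
        0 < Panel.sigmaDeltaSq μ c P s epsHat →
        Integrable (fun ω => Panel.Delta μ c P s epsHat ω ^ K) μ ∧
        Integrable (fun ω =>
          (Panel.moment μ c P s epsHat K - Panel.momentRand μ c P s epsHat K ω) ^ 2) μ ∧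
        ∫ ω, (Panel.moment μ c P s epsHat K - Panel.momentRand μ c P s epsHat K ω) ^ 2 ∂μ ≤
          a (Panel.luxemburgNorm μ ε) / Panel.sigmaDeltaSq μ c P s epsHat ^ K * (1 / (M : ℝ)) := by
  refine ⟨fun C => Panel.momentConst K (C + 1), ?_⟩
  intro N T M D Ω _ μ _ c P s X β ε Y epsHat hP hP2 hs hε h0 hsub hind hY hR hpos
  obtain rfl : epsHat = fun ω => Panel.mosaicResid c P X (ε ω) :=
    funext fun ω => by rw [hR, hY, Panel.mosaicResid_add_covariates]
  have hκ := Panel.luxemburgNorm_add_one_mem hsub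
  obtain ⟨hT, hM⟩ := Panel.pos_of_sigmaDeltaSq_pos hpos
  have hZ := Panel.isIndepFamily_clusterForm c P X hε hκ h0 hind (Panel.edgeCoeff P s)
  refine Panel.moment_comparison hT hM hP hP2 hs hZ hpos K
    (Panel.momentBound_nonneg K (Panel.luxemburgNorm μ ε + 1)) fun p => ?_
  by_cases hp : p.1 < p.2
  · have h := Panel.integral_bilinear_pow_le c P s X hT hP hP2 hs hε hκ h0 hind hp.ne K
    simpa [Panel.edgeForm, Panel.pairWeight, hp, Panel.residForm] using h
  -- The edge form is zero here, but its power of order `2K` is `1` when `K = 0`; the bound is then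
  -- `4`.
  · rcases K with _ | K
    · simp [Panel.momentBound]
    · simpa [Panel.edgeForm, Panel.pairWeight, hp] using Panel.momentBound_nonneg _ _
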